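/- Let $T=(V,E)$ be a locally finite tree and let $\nu$ be a probability measure on $\mathbb{R}$ of linear growth, i.e. there are $0<c<C<\infty$ with $c\,\varepsilon\le\nu((-\varepsilon,\varepsilon))\le C\,\varepsilon$ for all sufficiently small $\varepsilon>0$. Let the couplings $J=(J_e)_{e\in E}$ be i.i.d. with law $\nu$, i.e. $J$ has law $\nu^E$. Let $\mathcal{G}(J)$ be the set of ground states: all $\sigma\in\{-1,+1\}^V$ such that $\sum_{\{x,y\}\in\partial B}J_{xy}\sigma_x\sigma_y\ge 0$ for every finite $B\subset V$, where $\partial B$ is the set of edges with exactly one end in $B$. For a vertex $0\in V$, orient all edges away from $0$, writing $x\to y$ if $\{x,y\}\in E$ and $x$ is closer to $0$ than $y$. For capacities $\kappa_e\ge 0$, a flow from $0$ to $\infty$ is a function $\theta:E\to[0,\infty)$ with $\theta(e)\le\kappa_e$ for all $e\in E$ and $\sum_{x:\,x\to y}\theta(\{x,y\})=\sum_{z:\,y\to z}\theta(\{y,z\})$ for every $y\neq 0$; its strength is $\sum_{x:\,0\to x}\theta(\{0,x\})$, and $\mathrm{MaxFlow}(0\to\infty,\langle\kappa_e\rangle)$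 is the largest strength of such a flow. (a) If for some vertex $0\in V$ we have $\mathrm{MaxFlow}(0\to\infty,\langle|J_e|\rangle)>0$ almost surely, then $|\mathcal{G}(J)|=\infty$ almost surely. (b) Consequently, for every such $T$ and $\nu$, either $|\mathcal{G}(J)|=2$ almost surely, or $|\mathcal{G}(J)|=\infty$ almost surely. -/

import Mathlib

open MeasureTheory Filter Topology

noncomputable section

namespace SpinGlass

variable {V : Type*}

/-- A law `ν` on `ℝ` is of linear growth: `ν((-ε, ε)) = Θ(ε)` as `ε ↓ 0`. -/
def IsLinearGrowth (ν : Measure ℝ) : Prop :=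
  ∃ c C : ℝ, 0 < c ∧ c < C ∧
    ∀ᶠ ε in 𝓝[>] (0 : ℝ), c * ε ≤ ν.real (Set.Ioo (-ε) ε) ∧ ν.real (Set.Ioo (-ε) ε) ≤ C * ε

/-- The law `ν^E` of i.i.d. couplings with law `ν`, one for each edge of `G`. -/
abbrev couplingLaw (G : SimpleGraph V) (ν : Measure ℝ) : Measure (G.edgeSet → ℝ) :=
  Measure.infinitePi (fun _ : G.edgeSet => ν)

/-- The product `σ_x σ_y` of the two spins at the ends of `s(x, y)`; a spin configuration is a
function to `ℤˣ = {-1, 1}`. -/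
def spinProd (σ : V → ℤˣ) : Sym2 V → ℝ :=
  Sym2.lift ⟨fun x y => ((σ x : ℤ) : ℝ) * ((σ y : ℤ) : ℝ), fun _ _ => mul_comm _ _⟩

/-- The set `∂B` of edges with exactly one end in `B`. -/
def edgeBoundary (G : SimpleGraph V) (B : Set V) : Set G.edgeSet :=
  {e | ∃ x ∈ B, ∃ y ∉ B, (e : Sym2 V) = s(x, y)}

/-- `σ` is a ground state for the couplings `J`: `∑_{(x,y) ∈ ∂B} J_{xy} σ_x σ_y ≥ 0` for every
finite `B`. (For locally finite `G`, the boundary of a finite set is finite.) -/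
def IsGroundState (G : SimpleGraph V) (J : G.edgeSet → ℝ) (σ : V → ℤˣ) : Prop :=
  ∀ B : Finset V, 0 ≤ ∑ᶠ (e : G.edgeSet) (_ : e ∈ edgeBoundary G (B : Set V)), J e * spinProd σ e

/-- The set `𝒢(J)` of ground states. -/
def groundStates (G : SimpleGraph V) (J : G.edgeSet → ℝ) : Set (V → ℤˣ) :=
  {σ | IsGroundState G J σ}

/-- `x → y` in the tree `G` with root `o`: `x` and `y` are adjacent and `x` is the end of the
edge that lies closer to the root. -/
def Arrow (G : SimpleGraph V) (o x y : V) : Prop :=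
  G.Adj x y ∧ G.dist o y = G.dist o x + 1

/-- Total amount of `θ` entering `y` from the side of the root. -/
def inflow (G : SimpleGraph V) (o : V) (θ : G.edgeSet → ℝ) (y : V) : ℝ :=
  ∑ᶠ x : {x : V // Arrow G o x y}, θ ⟨s(x.1, y), x.2.1⟩

/-- Total amount of `θ` leaving `y` away from the root. -/
def outflow (G : SimpleGraph V) (o : V) (θ : G.edgeSet → ℝ) (y : V) : ℝ :=
  ∑ᶠ z : {z : V // Arrow G o y z}, θ ⟨s(y, z.1), z.2.1⟩

/-- `θ` is a flow from `o` to `∞` with respect to the capacities `κ`. -/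
structure IsFlow (G : SimpleGraph V) (o : V) (κ θ : G.edgeSet → ℝ) : Prop where
  nonneg : ∀ e, 0 ≤ θ e
  conserved : ∀ y, y ≠ o → inflow G o θ y = outflow G o θ y
  le_capacity : ∀ e, θ e ≤ κ e

/-- `MaxFlow(o → ∞, ⟨κ_e⟩)`: the largest strength (outflow at the root) of a flow from `o` to `∞`
with respect to the capacities `κ`. For locally finite `G` and `κ ≥ 0` the set of strengths is
non-empty and bounded above, see `isFlow_zero` and `bddAbove_strength`. -/
def maxFlow (G : SimpleGraph V) (o : V) (κ : G.edgeSet → ℝ) : ℝ :=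
  sSup {s | ∃ θ, IsFlow G o κ θ ∧ outflow G o θ o = s}

theorem finite_arrow (G : SimpleGraph V) [G.LocallyFinite] (o y : V) :
    Finite {z : V // Arrow G o y z} :=
  Finite.of_injective (fun z => (⟨z.1, z.2.1⟩ : G.neighborSet y))
    (fun _ _ h => Subtype.ext (congrArg (fun t => t.1) h))

theorem bddAbove_strength (G : SimpleGraph V) [G.LocallyFinite] (o : V) (κ : G.edgeSet → ℝ) :
    BddAbove {s | ∃ θ, IsFlow G o κ θ ∧ outflow G o θ o = s} := by
  have := finite_arrow G o o
  refine ⟨outflow G o κ o, ?_⟩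
  rintro _ ⟨θ, hθ, rfl⟩
  have := Fintype.ofFinite {z : V // Arrow G o o z}
  rw [outflow, outflow, finsum_eq_sum_of_fintype, finsum_eq_sum_of_fintype]
  exact Finset.sum_le_sum fun z _ => hθ.le_capacity _

theorem isFlow_zero (G : SimpleGraph V) (o : V) (κ : G.edgeSet → ℝ) (hκ : ∀ e, 0 ≤ κ e) :
    IsFlow G o κ (fun _ => 0) :=
  ⟨fun _ => le_rfl, fun _ _ => by simp [inflow, outflow], hκ⟩

end SpinGlass

end

noncomputable section

namespace SpinGlass

variable {V : Type*}

/-- A locally finite rooted tree, given by its parent function and its finite sets of children. -/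
structure RootedTree (V : Type*) where
  root : V
  par : V → V
  ch : V → Finset V
  depth : V → ℕ
  mem_ch : ∀ v w, w ∈ ch v ↔ w ≠ root ∧ par w = v
  depth_par : ∀ w, w ≠ root → depth w = depth (par w) + 1
  par_root : par root = root
  depth_root : depth root = 0

namespace RootedTree

variable (T : RootedTree V)

theorem depth_of_mem_ch {v w : V} (h : w ∈ T.ch v) : T.depth w = T.depth v + 1 := by
  obtain ⟨h1, rfl⟩ := (T.mem_ch _ _).1 h
  exact T.depth_par w h1

theorem par_of_mem_ch {v w : V} (h : w ∈ T.ch v) : T.par w = v := ((T.mem_ch _ _).1 h).2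

theorem ne_root_of_mem_ch {v w : V} (h : w ∈ T.ch v) : w ≠ T.root := ((T.mem_ch _ _).1 h).1

theorem mem_ch_par {w : V} (h : w ≠ T.root) : w ∈ T.ch (T.par w) := (T.mem_ch _ _).2 ⟨h, rfl⟩

theorem depth_iterate_le (v : V) (n : ℕ) : T.depth (T.par^[n] v) ≤ T.depth v := by
  induction n with
  | zero => simp
  | succ n ih =>
    rw [Function.iterate_succ_apply']
    by_cases h : T.par^[n] v = T.root
    · rw [h, T.par_root, ← h]; exact ih
    · have := T.depth_par _ h; omega

theorem root_of_depth_eq_zero {v : V} (h : T.depth v = 0) : v = T.root := by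
  by_contra hv
  have := T.depth_par v hv
  omega

theorem iterate_depth (v : V) : T.par^[T.depth v] v = T.root := by
  induction h : T.depth v generalizing v with
  | zero => exact T.root_of_depth_eq_zero h
  | succ n ih =>
    rw [Function.iterate_succ_apply]
    refine ih _ ?_
    have : v ≠ T.root := by rintro rfl; rw [T.depth_root] at h; omega
    have := T.depth_par v this
    omega

theorem ch_disjoint {v w : V} (h : v ≠ w) : Disjoint (T.ch v) (T.ch w) := by
  rw [Finset.disjoint_left]
  intro x hv hw
  exact h ((T.par_of_mem_ch hv).symm.trans (T.par_of_mem_ch hw))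

/-- `w` is a descendant of `v` (or equal to it). -/
def IsDesc (v w : V) : Prop := ∃ n, T.par^[n] w = v

theorem isDesc_refl (v : V) : T.IsDesc v v := ⟨0, rfl⟩

theorem IsDesc.of_par {v w : V} (h : T.IsDesc v (T.par w)) : T.IsDesc v w := by
  obtain ⟨n, hn⟩ := h
  exact ⟨n + 1, by rw [Function.iterate_succ_apply, hn]⟩

theorem IsDesc.trans {u v w : V} (h : T.IsDesc u v) (h' : T.IsDesc v w) : T.IsDesc u w := by
  obtain ⟨n, rfl⟩ := h
  obtain ⟨m, rfl⟩ := h'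
  exact ⟨n + m, by rw [Function.iterate_add_apply]⟩

theorem IsDesc.ch {v w x : V} (h : T.IsDesc v w) (hx : x ∈ T.ch w) : T.IsDesc v x :=
  IsDesc.of_par T (by rwa [T.par_of_mem_ch hx])

theorem IsDesc.par {v w : V} (h : T.IsDesc v w) (hne : w ≠ v) : T.IsDesc v (T.par w) := by
  obtain ⟨n, hn⟩ := h
  cases n with
  | zero => exact absurd hn hne
  | succ n => exact ⟨n, by rwa [Function.iterate_succ_apply] at hn⟩

theorem IsDesc.depth_le {v w : V} (h : T.IsDesc v w) : T.depth v ≤ T.depth w := by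
  obtain ⟨n, rfl⟩ := h
  exact T.depth_iterate_le w n

theorem not_isDesc_par {v : V} (h : v ≠ T.root) : ¬ T.IsDesc v (T.par v) := fun h' => by
  have h1 := h'.depth_le
  have h2 := T.depth_par v h
  omega

theorem IsDesc.ne_root {v w : V} (h : T.IsDesc v w) (hv : v ≠ T.root) : w ≠ T.root := by
  rintro rfl
  exact hv (T.root_of_depth_eq_zero (by have := h.depth_le; rw [T.depth_root] at this; omega))

theorem eq_of_isDesc_of_depth {v w : V} (h : T.IsDesc v w) (hd : T.depth w ≤ T.depth v) :
    w = v := by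
  by_contra hne
  by_cases hw : w = T.root
  · subst hw
    rw [T.depth_root] at *
    refine hne (T.root_of_depth_eq_zero ?_).symm
    have := h.depth_le
    rw [T.depth_root] at this
    omega
  · have h1 := (IsDesc.par T h hne).depth_le
    have h2 := T.depth_par w hw
    omega

/-- Subtrees below different siblings are disjoint. -/
theorem not_isDesc_sibling {u A A' w : V} (hA : A ∈ T.ch u) (hA' : A' ∈ T.ch u) (hne : A ≠ A')
    (h : T.IsDesc A w) : ¬ T.IsDesc A' w := by
  rintro ⟨n, hn⟩
  obtain ⟨m, hm⟩ := h
  have key : ∀ {x y : V} {i j : ℕ}, i ≤ j → T.par^[i] w = x → T.par^[j] w = y →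
      T.depth x = T.depth y → x = y := by
    intro x y i j hij hi hj hd
    obtain ⟨l, rfl⟩ := Nat.exists_eq_add_of_le' hij
    refine T.eq_of_isDesc_of_depth ⟨l, ?_⟩ hd.le
    rw [← hi, ← Function.iterate_add_apply, hj]
  have hd : T.depth A = T.depth A' := by
    rw [T.depth_of_mem_ch hA, T.depth_of_mem_ch hA']
  rcases le_total n m with h | h
  · exact hne (key h hn hm hd.symm).symm
  · exact hne (key h hm hn hd)

open Classical in
/-- The vertices `w` below `v` which are the outer ends of edges cutting `v` off from infinity. -/
def cut (v : V) (B : Finset V) : Finset V :=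
  ((insert v (B.biUnion T.ch)).filter (fun w => T.IsDesc v w ∧ w ∉ B ∧ (w = v ∨ T.par w ∈ B)))

theorem mem_cut {v w : V} {B : Finset V} :
    w ∈ T.cut v B ↔ T.IsDesc v w ∧ w ∉ B ∧ (w = v ∨ T.par w ∈ B) := by
  classical
  rw [cut, Finset.mem_filter, and_iff_right_iff_imp]
  rintro ⟨h1, h2, h3⟩
  rw [Finset.mem_insert, Finset.mem_biUnion]
  by_cases hwv : w = v
  · exact Or.inl hwv
  · refine Or.inr ⟨T.par w, h3.resolve_left hwv, T.mem_ch_par ?_⟩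
    rintro rfl
    exact hwv (T.root_of_depth_eq_zero (by
      have := h1.depth_le; rw [T.depth_root] at this; omega)).symm

/-- A quantity which is not lost on the way down is bounded by its total over any finite cut. -/
theorem le_sum_cut {θ : V → ℝ} (h0 : ∀ v, 0 ≤ θ v) (h : ∀ v, θ v ≤ ∑ w ∈ T.ch v, θ w)
    (v : V) (B : Finset V) : θ v ≤ ∑ w ∈ T.cut v B, θ w := by
  classical
  by_cases hv : v ∉ B
  · exact Finset.single_le_sum (f := θ) (fun w _ => h0 w)
      (T.mem_cut.2 ⟨T.isDesc_refl v, hv, Or.inl rfl⟩)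
  rw [not_not] at hv
  set D := B.filter (T.IsDesc v) with hD
  have hvD : v ∈ D := by simp [hD, hv, T.isDesc_refl]
  have h1 : ∑ u ∈ D, θ u ≤ ∑ w ∈ D.biUnion T.ch, θ w := by
    rw [Finset.sum_biUnion (fun x _ y _ hxy => T.ch_disjoint hxy)]
    exact Finset.sum_le_sum fun u _ => h u
  have h2 : D.biUnion T.ch ⊆ D.erase v ∪ T.cut v B := by
    intro w hw
    rw [Finset.mem_biUnion] at hw
    obtain ⟨u, hu, hwu⟩ := hw
    rw [hD, Finset.mem_filter] at hu
    have hdw : T.IsDesc v w := hu.2.ch T hwu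
    rw [Finset.mem_union, T.mem_cut, Finset.mem_erase, hD, Finset.mem_filter,
      T.par_of_mem_ch hwu]
    by_cases hwB : w ∈ B
    · refine Or.inl ⟨?_, hwB, hdw⟩
      rintro rfl
      have := hu.2.depth_le
      have := T.depth_of_mem_ch hwu
      omega
    · exact Or.inr ⟨hdw, hwB, Or.inr hu.1⟩
  have h3 : ∑ w ∈ D.biUnion T.ch, θ w ≤ ∑ w ∈ D.erase v, θ w + ∑ w ∈ T.cut v B, θ w := by
    refine (Finset.sum_le_sum_of_subset_of_nonneg h2 fun w _ _ => h0 w).trans ?_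
    rw [← Finset.sum_union_inter]
    exact le_add_of_nonneg_right (Finset.sum_nonneg fun w _ => h0 w)
  have h4 := Finset.add_sum_erase D θ hvD
  linarith

/-- The `n`-th approximation from above to the maximal flow into `v` and on to infinity. -/
def trunc (k : V → ℝ) : ℕ → V → ℝ
  | 0, v => k v
  | n + 1, v => min (k v) (∑ w ∈ T.ch v, trunc k n w)

/-- The maximal flow into `v` (through the edge to its parent) and on to infinity. -/
def flowTo (k : V → ℝ) (v : V) : ℝ := ⨅ n, T.trunc k n v

section

variable {k : V → ℝ}

theorem trunc_nonneg (hk : ∀ v, 0 ≤ k v) (n : ℕ) (v : V) : 0 ≤ T.trunc k n v := by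
  induction n generalizing v with
  | zero => exact hk v
  | succ n ih => exact le_min (hk v) (Finset.sum_nonneg fun w _ => ih w)

theorem trunc_antitone (v : V) : Antitone fun n => T.trunc k n v := by
  refine antitone_nat_of_succ_le fun n => ?_
  induction n generalizing v with
  | zero => exact min_le_left _ _
  | succ n ih => exact min_le_min le_rfl (Finset.sum_le_sum fun w _ => ih w)

theorem bddBelow_trunc (hk : ∀ v, 0 ≤ k v) (v : V) :
    BddBelow (Set.range fun n => T.trunc k n v) :=
  ⟨0, by rintro _ ⟨n, rfl⟩; exact T.trunc_nonneg hk n v⟩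

theorem tendsto_trunc (hk : ∀ v, 0 ≤ k v) (v : V) :
    Tendsto (fun n => T.trunc k n v) atTop (𝓝 (T.flowTo k v)) :=
  tendsto_atTop_ciInf (T.trunc_antitone v) (T.bddBelow_trunc hk v)

theorem flowTo_nonneg (hk : ∀ v, 0 ≤ k v) (v : V) : 0 ≤ T.flowTo k v :=
  le_ciInf fun n => T.trunc_nonneg hk n v

theorem flowTo_le_trunc (hk : ∀ v, 0 ≤ k v) (n : ℕ) (v : V) : T.flowTo k v ≤ T.trunc k n v :=
  ciInf_le (T.bddBelow_trunc hk v) n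

theorem flowTo_le (hk : ∀ v, 0 ≤ k v) (v : V) : T.flowTo k v ≤ k v := T.flowTo_le_trunc hk 0 v

theorem flowTo_eq (hk : ∀ v, 0 ≤ k v) (v : V) :
    T.flowTo k v = min (k v) (∑ w ∈ T.ch v, T.flowTo k w) := by
  refine tendsto_nhds_unique ((tendsto_add_atTop_iff_nat 1).2 (T.tendsto_trunc hk v)) ?_
  exact tendsto_const_nhds.min (tendsto_finsetSum _ fun w _ => T.tendsto_trunc hk w)

theorem flowTo_le_sum (hk : ∀ v, 0 ≤ k v) (v : V) :
    T.flowTo k v ≤ ∑ w ∈ T.ch v, T.flowTo k w :=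
  (T.flowTo_eq hk v).trans_le (min_le_right _ _)

theorem flowTo_pos_par (hk : ∀ v, 0 < k v) {v : V} (hv : 0 < T.flowTo k v) :
    0 < T.flowTo k (T.par v) := by
  have hk' := fun v => (hk v).le
  by_cases h : v = T.root
  · subst h
    rwa [T.par_root]
  rw [T.flowTo_eq hk']
  exact lt_min (hk _) (hv.trans_le (Finset.single_le_sum (f := T.flowTo k)
    (fun w _ => T.flowTo_nonneg hk' w) (T.mem_ch_par h)))

theorem flowTo_pos_iterate (hk : ∀ v, 0 < k v) {v : V} (hv : 0 < T.flowTo k v) (n : ℕ) :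
    0 < T.flowTo k (T.par^[n] v) := by
  induction n with
  | zero => exact hv
  | succ n ih => rw [Function.iterate_succ_apply']; exact T.flowTo_pos_par hk ih

theorem mul_trunc_le {k' : V → ℝ} {c : ℝ} (hc : 0 ≤ c) (h : ∀ v, c * k' v ≤ k v)
    (n : ℕ) (v : V) : c * T.trunc k' n v ≤ T.trunc k n v := by
  induction n generalizing v with
  | zero => exact h v
  | succ n ih =>
    simp only [trunc]
    rw [mul_min_of_nonneg _ _ hc, Finset.mul_sum]
    exact min_le_min (h v) (Finset.sum_le_sum fun w _ => ih w)

theorem mul_flowTo_le {k' : V → ℝ} {c : ℝ} (hc : 0 ≤ c) (hk' : ∀ v, 0 ≤ k' v)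
    (h : ∀ v, c * k' v ≤ k v) (v : V) : c * T.flowTo k' v ≤ T.flowTo k v :=
  le_ciInf fun n => (mul_le_mul_of_nonneg_left (T.flowTo_le_trunc hk' n v) hc).trans
    (T.mul_trunc_le hc h n v)

end

theorem min_sum_le {ι : Type*} (s : Finset ι) {f : ι → ℝ} (hf : ∀ i, 0 ≤ f i) {b : ℝ}
    (hb : 0 ≤ b) : min b (∑ i ∈ s, f i) ≤ ∑ i ∈ s, min b (f i) := by
  classical
  induction s using Finset.induction_on with
  | empty => simp
  | insert i s hi ih =>
    rw [Finset.sum_insert hi, Finset.sum_insert hi]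
    have h1 : 0 ≤ ∑ i ∈ s, f i := Finset.sum_nonneg fun i _ => hf i
    have h2 := hf i
    refine le_trans ?_ (add_le_add le_rfl ih)
    rcases min_cases b (f i) with h | h <;> rcases min_cases b (∑ i ∈ s, f i) with h' | h' <;>
      rcases min_cases b (f i + ∑ i ∈ s, f i) with h'' | h'' <;> linarith

/-- The running minimum of `a` along ancestors. -/
def runMin (a : V → ℝ) : ℕ → V → ℝ
  | 0, v => a v
  | n + 1, v => min (runMin a n (T.par v)) (a v)

theorem exists_decreasing_superflow {a : V → ℝ} (ha : ∀ v, 0 ≤ a v)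
    (h : ∀ v, a v ≤ ∑ w ∈ T.ch v, a w) :
    ∃ θ : V → ℝ, (∀ v, 0 ≤ θ v) ∧ (∀ v, θ v ≤ a v) ∧ (∀ v, θ v ≤ ∑ w ∈ T.ch v, θ w) ∧
      (∀ v, ∀ w ∈ T.ch v, θ w ≤ θ v) ∧ ∀ v, (∀ n, 0 < a (T.par^[n] v)) → 0 < θ v := by
  have hle : ∀ n v, T.runMin a n v ≤ a v := by
    rintro (_ | n) v
    · exact le_rfl
    · exact min_le_right _ _
  have h0 : ∀ n v, 0 ≤ T.runMin a n v := by
    intro n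
    induction n with
    | zero => exact ha
    | succ n ih => exact fun v => le_min (ih _) (ha v)
  have hch : ∀ v, ∀ w ∈ T.ch v,
      T.runMin a (T.depth w) w = min (T.runMin a (T.depth v) v) (a w) := by
    intro v w hw
    rw [T.depth_of_mem_ch hw, runMin, T.par_of_mem_ch hw]
  refine ⟨fun v => T.runMin a (T.depth v) v, fun v => h0 _ _, fun v => hle _ _, fun v => ?_,
    fun v w hw => (hch v w hw).trans_le (min_le_left _ _), fun v hv => ?_⟩
  · rw [Finset.sum_congr rfl (hch v)]
    refine le_trans ?_ (min_sum_le _ ha (h0 _ _))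
    exact le_min le_rfl ((hle _ _).trans (h v))
  · have : ∀ n v, (∀ n, 0 < a (T.par^[n] v)) → 0 < T.runMin a n v := by
      intro n
      induction n with
      | zero => exact fun v hv => hv 0
      | succ n ih =>
        refine fun v hv => lt_min (ih _ fun m => ?_) (hv 0)
        rw [← Function.iterate_succ_apply]
        exact hv _
    exact this _ v hv

open Classical in
/-- The descendants of `v` in the `n`-th generation. -/
def gen (v : V) : ℕ → Finset V
  | 0 => {v}
  | n + 1 => (gen v n).biUnion T.ch

theorem isDesc_and_depth_of_mem_gen {v w : V} {n : ℕ} (h : w ∈ T.gen v n) :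
    T.IsDesc v w ∧ T.depth w = T.depth v + n := by
  classical
  induction n generalizing w with
  | zero =>
    rw [gen, Finset.mem_singleton] at h
    subst h
    exact ⟨T.isDesc_refl _, rfl⟩
  | succ n ih =>
    rw [gen, Finset.mem_biUnion] at h
    obtain ⟨u, hu, hw⟩ := h
    refine ⟨(ih hu).1.ch T hw, ?_⟩
    rw [T.depth_of_mem_ch hw, (ih hu).2]
    ring

theorem mem_gen_root (v : V) : v ∈ T.gen T.root (T.depth v) := by
  classical
  induction h : T.depth v generalizing v with
  | zero => rw [gen, T.root_of_depth_eq_zero h]; simp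
  | succ n ih =>
    have hv : v ≠ T.root := by rintro rfl; rw [T.depth_root] at h; omega
    rw [gen, Finset.mem_biUnion]
    refine ⟨T.par v, ih _ ?_, T.mem_ch_par hv⟩
    have := T.depth_par v hv
    omega

theorem countable_vertices (T : RootedTree V) : Countable V := by
  have : (⋃ n, (T.gen T.root n : Set V)) = Set.univ :=
    Set.eq_univ_of_forall fun v => Set.mem_iUnion.2 ⟨_, T.mem_gen_root v⟩
  rw [← Set.countable_univ_iff, ← this]
  exact Set.countable_iUnion fun n => (T.gen T.root n).countable_toSet

theorem le_sum_gen {g : V → ℝ} (h : ∀ v, g v ≤ ∑ w ∈ T.ch v, g w) (v : V) (n : ℕ) :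
    g v ≤ ∑ w ∈ T.gen v n, g w := by
  classical
  induction n with
  | zero => simp [gen]
  | succ n ih =>
    rw [gen, Finset.sum_biUnion (fun x _ y _ hxy => T.ch_disjoint hxy)]
    exact ih.trans (Finset.sum_le_sum fun u _ => h u)

theorem exists_finset_le_sum {g : V → ℝ} (h : ∀ v, g v ≤ ∑ w ∈ T.ch v, g w) (v : V) (n : ℕ) :
    ∃ F : Finset V, (∀ w ∈ F, T.IsDesc v w) ∧ n * g v ≤ ∑ w ∈ F, g w := by
  classical
  refine ⟨(Finset.range n).biUnion (T.gen v), fun w hw => ?_, ?_⟩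
  · obtain ⟨m, -, hm⟩ := Finset.mem_biUnion.1 hw
    exact (T.isDesc_and_depth_of_mem_gen hm).1
  · rw [Finset.sum_biUnion]
    · refine le_trans ?_ (Finset.sum_le_sum fun m _ => T.le_sum_gen h v m)
      simp
    · intro m _ m' _ hmm
      refine Finset.disjoint_left.2 fun w hw hw' => hmm ?_
      have h1 := (T.isDesc_and_depth_of_mem_gen hw).2
      have h2 := (T.isDesc_and_depth_of_mem_gen hw').2
      omega

/-- The approximation `trunc k n v` is attained by a finite cut. -/
theorem exists_cut_le_trunc {k : V → ℝ} (hk : ∀ v, 0 ≤ k v) (n : ℕ) (v : V) :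
    ∃ B : Finset V, (∀ w ∈ B, T.IsDesc v w) ∧ (∀ w ∈ B, w ≠ v → T.par w ∈ B) ∧
      ∑ w ∈ T.cut v B, k w ≤ T.trunc k n v := by
  classical
  have hempty : ∑ w ∈ T.cut v ∅, k w ≤ k v := by
    have : T.cut v ∅ ⊆ {v} := fun w hw => by
      simpa using (T.mem_cut.1 hw).2.2
    simpa using Finset.sum_le_sum_of_subset_of_nonneg (f := k) this fun w _ _ => hk w
  induction n generalizing v with
  | zero => exact ⟨∅, by simp, by simp, hempty⟩
  | succ n ih =>
    by_cases hle : k v ≤ ∑ w ∈ T.ch v, T.trunc k n w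
    · exact ⟨∅, by simp, by simp, by rw [trunc, min_eq_left hle]; exact hempty⟩
    rw [trunc, min_eq_right (not_le.1 hle).le]
    have ih' : ∀ w, ∃ B : Finset V, (∀ u ∈ B, T.IsDesc w u) ∧
        (∀ u ∈ B, u ≠ w → T.par u ∈ B) ∧ ∑ u ∈ T.cut w B, k u ≤ T.trunc k n w := fun w => by
      refine ih w ?_
      have : T.cut w ∅ ⊆ {w} := fun u hu => by
        simpa using (T.mem_cut.1 hu).2.2
      simpa using Finset.sum_le_sum_of_subset_of_nonneg (f := k) this fun w _ _ => hk w
    choose B hB hBp hBk using ih'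
    refine ⟨insert v ((T.ch v).biUnion B), fun w hw => ?_, fun w hw hwv => ?_, ?_⟩
    · rcases Finset.mem_insert.1 hw with rfl | hw
      · exact T.isDesc_refl _
      · obtain ⟨u, hu, hw⟩ := Finset.mem_biUnion.1 hw
        exact IsDesc.trans T ((T.isDesc_refl v).ch T hu) (hB u w hw)
    · obtain ⟨u, hu, hwu⟩ := Finset.mem_biUnion.1 ((Finset.mem_insert.1 hw).resolve_left hwv)
      by_cases h : w = u
      · rw [h, T.par_of_mem_ch hu]
        exact Finset.mem_insert_self _ _
      · exact Finset.mem_insert_of_mem (Finset.mem_biUnion.2 ⟨u, hu, hBp u w hwu h⟩)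
    · have hsub : T.cut v (insert v ((T.ch v).biUnion B)) ⊆
          (T.ch v).biUnion fun w => T.cut w (B w) := by
        intro u hu
        rw [T.mem_cut] at hu
        obtain ⟨h1, h2, h3⟩ := hu
        have huv : u ≠ v := fun h => h2 (by simp [h])
        have hur : u ≠ T.root := by
          rintro rfl
          exact huv (T.eq_of_isDesc_of_depth h1 (by rw [T.depth_root]; omega))
        rw [Finset.mem_insert, not_or, Finset.mem_biUnion] at h2
        rw [Finset.mem_biUnion]
        rcases Finset.mem_insert.1 (h3.resolve_left huv) with hp | hp
        · have huc : u ∈ T.ch v := (T.mem_ch _ _).2 ⟨hur, hp⟩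
          exact ⟨u, huc, T.mem_cut.2 ⟨T.isDesc_refl u, fun h => h2.2 ⟨u, huc, h⟩, Or.inl rfl⟩⟩
        · obtain ⟨w, hw, hpw⟩ := Finset.mem_biUnion.1 hp
          exact ⟨w, hw, T.mem_cut.2 ⟨IsDesc.of_par T (hB w _ hpw),
            fun h => h2.2 ⟨w, hw, h⟩, Or.inr hpw⟩⟩
      refine (Finset.sum_le_sum_of_subset_of_nonneg hsub fun w _ _ => hk w).trans ?_
      refine le_trans ?_ (Finset.sum_le_sum fun w _ => hBk w)
      generalize T.ch v = s
      induction s using Finset.induction_on with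
      | empty => simp
      | insert i s hi ih =>
        rw [Finset.biUnion_insert, Finset.sum_insert hi]
        refine le_trans ?_ (add_le_add le_rfl ih)
        rw [← Finset.sum_union_inter]
        exact le_add_of_nonneg_right (Finset.sum_nonneg fun w _ => hk w)

/-- Every sign pattern on the edges is realised by spins at the vertices. -/
theorem exists_spins (s : V → ℤˣ) : ∃ τ : V → ℤˣ, ∀ w, w ≠ T.root → τ w = s w * τ (T.par w) := by
  refine ⟨fun v => ∏ i ∈ Finset.range (T.depth v), s (T.par^[i] v), fun w hw => ?_⟩
  simp only [T.depth_par w hw, Finset.prod_range_succ', Function.iterate_zero, id_eq,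
    Function.iterate_succ_apply]
  rw [mul_comm]

end RootedTree

/-- The graph `G` is the tree `T` with orientations away from the root forgotten. -/
structure RootedTree.Spans (T : RootedTree V) (G : SimpleGraph V) : Prop where
  arrow_iff : ∀ x y, Arrow G T.root x y ↔ y ∈ T.ch x
  adj_iff : ∀ x y, G.Adj x y ↔ y ∈ T.ch x ∨ x ∈ T.ch y

theorem exists_arrow {G : SimpleGraph V} (hG : G.IsTree) (o : V) {w : V} (hw : w ≠ o) :
    ∃ v, Arrow G o v w := by
  obtain ⟨p, hp⟩ := (hG.connected w o).exists_walk_length_eq_dist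
  cases p with
  | nil => exact absurd rfl hw
  | @cons _ u _ h q =>
    refine ⟨u, h.symm, ?_⟩
    rw [SimpleGraph.Walk.length_cons] at hp
    have h1 := SimpleGraph.dist_le q
    rw [G.dist_comm (u := o) (v := w), G.dist_comm (u := o) (v := u)]
    have h2 := hG.dist_eq_dist_add_one_of_adj o h
    rw [G.dist_comm (u := o) (v := w), G.dist_comm (u := o) (v := u)] at h2
    omega

theorem arrow_unique {G : SimpleGraph V} (hG : G.IsTree) {o u v w : V} (hu : Arrow G o u w)
    (hv : Arrow G o v w) : u = v := by
  obtain ⟨p, hp⟩ := (hG.connected o u).exists_walk_length_eq_dist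
  obtain ⟨q, hq⟩ := (hG.connected o v).exists_walk_length_eq_dist
  have hp' : (p.concat hu.1).IsPath := SimpleGraph.Walk.isPath_of_length_eq_dist _ (by
    rw [SimpleGraph.Walk.length_concat, hp, hu.2])
  have hq' : (q.concat hv.1).IsPath := SimpleGraph.Walk.isPath_of_length_eq_dist _ (by
    rw [SimpleGraph.Walk.length_concat, hq, hv.2])
  have := congrArg Subtype.val ((hG.isAcyclic.subsingleton_path o w).elim
    ⟨_, hp'⟩ ⟨_, hq'⟩)
  exact (SimpleGraph.Walk.concat_inj this).1

open Classical in
/-- The tree `G` rooted at `o`. -/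
def rootedAt (G : SimpleGraph V) [G.LocallyFinite] (hG : G.IsTree) (o : V) : RootedTree V where
  root := o
  par w := if h : w = o then o else (exists_arrow hG o h).choose
  ch v := (G.neighborFinset v).filter fun w => G.dist o w = G.dist o v + 1
  depth := G.dist o
  mem_ch v w := by
    rw [Finset.mem_filter, SimpleGraph.mem_neighborFinset]
    constructor
    · rintro ⟨h1, h2⟩
      have hw : w ≠ o := by rintro rfl; simp at h2
      rw [dif_neg hw]
      exact ⟨hw, arrow_unique hG (exists_arrow hG o hw).choose_spec ⟨h1, h2⟩⟩
    · rintro ⟨hw, rfl⟩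
      rw [dif_neg hw]
      exact (exists_arrow hG o hw).choose_spec
  depth_par w hw := by
    rw [dif_neg hw]
    exact (exists_arrow hG o hw).choose_spec.2
  par_root := by simp
  depth_root := by simp

theorem rootedAt_spans (G : SimpleGraph V) [G.LocallyFinite] (hG : G.IsTree) (o : V) :
    (rootedAt G hG o).Spans G := by
  have h : ∀ x y, Arrow G (rootedAt G hG o).root x y ↔ y ∈ (rootedAt G hG o).ch x := by
    intro x y
    simp [rootedAt, Arrow, Finset.mem_filter]
  refine ⟨h, fun x y => ?_⟩
  rw [← h, ← h]
  constructor
  · intro hxy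
    rcases hG.dist_eq_dist_add_one_of_adj o hxy with h | h
    · exact Or.inr ⟨hxy.symm, h⟩
    · exact Or.inl ⟨hxy, h⟩
  · rintro (h | h)
    · exact h.1
    · exact h.1.symm

namespace RootedTree.Spans

variable {T : RootedTree V} {G : SimpleGraph V} (hT : T.Spans G)

include hT

theorem adj_par {w : V} (hw : w ≠ T.root) : G.Adj (T.par w) w :=
  (hT.adj_iff _ _).2 (Or.inl (T.mem_ch_par hw))

/-- The edge from `w` to its parent. -/
def edgeAt (w : V) (hw : w ≠ T.root) : G.edgeSet := ⟨s(T.par w, w), hT.adj_par hw⟩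

theorem exists_edgeAt (e : G.edgeSet) : ∃ w, ∃ hw : w ≠ T.root, e = hT.edgeAt w hw := by
  obtain ⟨⟨x, y⟩, h⟩ := e
  rcases (hT.adj_iff x y).1 h with h | h
  · refine ⟨y, T.ne_root_of_mem_ch h, Subtype.ext ?_⟩
    simp [edgeAt, T.par_of_mem_ch h]
  · refine ⟨x, T.ne_root_of_mem_ch h, Subtype.ext ?_⟩
    simp [edgeAt, T.par_of_mem_ch h]

theorem edgeAt_inj {w w' : V} {hw : w ≠ T.root} {hw' : w' ≠ T.root} :
    hT.edgeAt w hw = hT.edgeAt w' hw' ↔ w = w' := by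
  constructor
  · intro h
    have := congrArg Subtype.val h
    simp only [edgeAt, Sym2.eq_iff] at this
    rcases this with ⟨-, h⟩ | ⟨h1, h2⟩
    · exact h
    · have h3 := T.depth_par w hw
      have h4 := T.depth_par w' hw'
      rw [h1] at h3
      rw [← h2] at h4
      omega
  · rintro rfl
    rfl

theorem edgeAt_mem_edgeBoundary {w : V} {hw : w ≠ T.root} {B : Set V} :
    hT.edgeAt w hw ∈ edgeBoundary G B ↔ (w ∈ B ∧ T.par w ∉ B) ∨ (w ∉ B ∧ T.par w ∈ B) := by
  constructor
  · rintro ⟨x, hx, y, hy, h⟩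
    simp only [edgeAt, Sym2.eq_iff] at h
    rcases h with ⟨rfl, rfl⟩ | ⟨rfl, rfl⟩
    · exact Or.inr ⟨hy, hx⟩
    · exact Or.inl ⟨hx, hy⟩
  · rintro (⟨h1, h2⟩ | ⟨h1, h2⟩)
    · exact ⟨w, h1, _, h2, Sym2.eq_swap⟩
    · exact ⟨_, h2, w, h1, rfl⟩

open Classical in
/-- A function on edges as a function on vertices: `w` carries the value of the edge to its parent,
and the root carries the value `1`. -/
def onVertices (κ : G.edgeSet → ℝ) (w : V) : ℝ :=
  if hw : w ≠ T.root then κ (hT.edgeAt w hw) else 1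

theorem onVertices_of_ne (κ : G.edgeSet → ℝ) {w : V} (hw : w ≠ T.root) :
    hT.onVertices κ w = κ (hT.edgeAt w hw) := dif_pos hw

theorem onVertices_root (κ : G.edgeSet → ℝ) : hT.onVertices κ T.root = 1 :=
  dif_neg (not_not.2 rfl)

theorem onVertices_nonneg {κ : G.edgeSet → ℝ} (h : ∀ e, 0 ≤ κ e) (w : V) :
    0 ≤ hT.onVertices κ w := by
  rw [onVertices]
  split_ifs
  exacts [h _, zero_le_one]

theorem onVertices_pos {κ : G.edgeSet → ℝ} (h : ∀ e, 0 < κ e) (w : V) :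
    0 < hT.onVertices κ w := by
  rw [onVertices]
  split_ifs
  exacts [h _, zero_lt_one]

theorem outflow_eq (θ : G.edgeSet → ℝ) (y : V) :
    outflow G T.root θ y = ∑ w ∈ T.ch y, hT.onVertices θ w := by
  have h : ∀ z : {z : V // Arrow G T.root y z},
      θ ⟨s(y, z.1), z.2.1⟩ = hT.onVertices θ z.1 := by
    rintro ⟨z, hz⟩
    have hz' := (hT.arrow_iff _ _).1 hz
    rw [hT.onVertices_of_ne θ (T.ne_root_of_mem_ch hz')]
    congr 1
    simp [edgeAt, T.par_of_mem_ch hz']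
  rw [outflow, finsum_congr h]
  refine (finsum_subtype_eq_finsum_cond (f := hT.onVertices θ)
    (fun z => Arrow G T.root y z)).trans ?_
  simp_rw [hT.arrow_iff]
  exact finsum_mem_finset_eq_sum _ _

theorem inflow_eq (θ : G.edgeSet → ℝ) {y : V} (hy : y ≠ T.root) :
    inflow G T.root θ y = hT.onVertices θ y := by
  have ha : Arrow G T.root (T.par y) y := (hT.arrow_iff _ _).2 (T.mem_ch_par hy)
  rw [inflow, finsum_eq_single _ (⟨T.par y, ha⟩ : {x : V // Arrow G T.root x y}),
    hT.onVertices_of_ne θ hy]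
  · rfl
  · rintro ⟨x, hx⟩ hne
    refine absurd (Subtype.ext ?_) hne
    exact (T.par_of_mem_ch ((hT.arrow_iff _ _).1 hx)).symm

theorem flowTo_root_pos_of_maxFlow_pos {κ : G.edgeSet → ℝ} (hκ : ∀ e, 0 ≤ κ e)
    (h : 0 < maxFlow G T.root κ) : 0 < T.flowTo (hT.onVertices κ) T.root := by
  have hk := hT.onVertices_nonneg hκ
  obtain ⟨θ, hθ, hs⟩ : ∃ θ, IsFlow G T.root κ θ ∧ 0 < outflow G T.root θ T.root := by
    by_contra hno
    push Not at hno
    refine h.not_ge (Real.sSup_nonpos ?_)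
    rintro _ ⟨θ, hθ, rfl⟩
    exact hno θ hθ
  rw [hT.outflow_eq] at hs
  have key : ∀ n w, w ≠ T.root → hT.onVertices θ w ≤ T.trunc (hT.onVertices κ) n w := by
    intro n
    induction n with
    | zero =>
      intro w hw
      rw [RootedTree.trunc, hT.onVertices_of_ne _ hw, hT.onVertices_of_ne _ hw]
      exact hθ.le_capacity _
    | succ n ih =>
      intro w hw
      refine le_min ?_ ?_
      · rw [hT.onVertices_of_ne _ hw, hT.onVertices_of_ne _ hw]
        exact hθ.le_capacity _
      · rw [← hT.inflow_eq θ hw, hθ.conserved w hw, hT.outflow_eq]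
        exact Finset.sum_le_sum fun u hu => ih u (T.ne_root_of_mem_ch hu)
  rw [T.flowTo_eq hk, hT.onVertices_root]
  refine lt_min one_pos (hs.trans_le (Finset.sum_le_sum fun w hw => ?_))
  exact le_ciInf fun n => key n w (T.ne_root_of_mem_ch hw)

theorem finite_edgeBoundary (B : Finset V) : (edgeBoundary G (B : Set V)).Finite := by
  classical
  refine Set.Finite.subset (s := {e | ∃ w ∈ B ∪ B.biUnion T.ch, ∃ hw, e = hT.edgeAt w hw}) ?_ ?_
  · refine Set.Finite.of_finite_image (f := fun e : G.edgeSet => (e : Sym2 V)) ?_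
      Subtype.val_injective.injOn
    refine (((B ∪ B.biUnion T.ch).image fun w => s(T.par w, w)).finite_toSet).subset ?_
    rintro _ ⟨_, ⟨w, hw, hwr, rfl⟩, rfl⟩
    exact Finset.mem_coe.2 (Finset.mem_image_of_mem _ hw)
  · intro e he
    obtain ⟨w, hw, rfl⟩ := hT.exists_edgeAt e
    refine ⟨w, ?_, hw, rfl⟩
    rw [Finset.mem_union, Finset.mem_biUnion]
    rcases (hT.edgeAt_mem_edgeBoundary).1 he with h | h
    · exact Or.inl (by exact_mod_cast h.1)
    · exact Or.inr ⟨_, by exact_mod_cast h.2, T.mem_ch_par hw⟩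

/-- The boundary of a finite set, as a finite set. -/
def boundary (B : Finset V) : Finset G.edgeSet := (hT.finite_edgeBoundary B).toFinset

theorem mem_boundary {B : Finset V} {e : G.edgeSet} :
    e ∈ hT.boundary B ↔ e ∈ edgeBoundary G (B : Set V) := Set.Finite.mem_toFinset _

theorem edgeAt_mem_boundary {w : V} {hw : w ≠ T.root} {B : Finset V} :
    hT.edgeAt w hw ∈ hT.boundary B ↔ (w ∈ B ∧ T.par w ∉ B) ∨ (w ∉ B ∧ T.par w ∈ B) := by
  rw [hT.mem_boundary, hT.edgeAt_mem_edgeBoundary]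
  simp

theorem isGroundState_iff (J : G.edgeSet → ℝ) (σ : V → ℤˣ) :
    IsGroundState G J σ ↔ ∀ B : Finset V, 0 ≤ ∑ e ∈ hT.boundary B, J e * spinProd σ e := by
  refine forall_congr' fun B => ?_
  rw [finsum_mem_eq_finite_toFinset_sum _ (hT.finite_edgeBoundary B)]
  rfl

theorem exists_spinProd_eq (s : G.edgeSet → ℤˣ) :
    ∃ τ : V → ℤˣ, ∀ e : G.edgeSet, spinProd τ e = ((s e : ℤ) : ℝ) := by
  classical
  obtain ⟨τ, hτ⟩ := T.exists_spins fun w => if hw : w ≠ T.root then s (hT.edgeAt w hw) else 1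
  refine ⟨τ, fun e => ?_⟩
  obtain ⟨w, hw, rfl⟩ := hT.exists_edgeAt e
  have h1 := hτ w hw
  rw [dif_pos hw] at h1
  have h2 : τ (T.par w) * τ w = s (hT.edgeAt w hw) := by
    rw [h1, mul_left_comm, Int.units_mul_self, mul_one]
  rw [← h2]
  simp [spinProd, edgeAt]

end RootedTree.Spans

theorem spinProd_eq_one_or (σ : V → ℤˣ) (z : Sym2 V) : spinProd σ z = 1 ∨ spinProd σ z = -1 := by
  induction z with
  | _ x y =>
    rcases Int.units_eq_one_or (σ x) with h | h <;> rcases Int.units_eq_one_or (σ y) with h' | h' <;>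
      simp [spinProd, h, h']

section Product

open ProbabilityTheory

variable {ι : Type*} (ν : Measure ℝ) [IsProbabilityMeasure ν]

theorem measurable_update_pair [DecidableEq ι] (i : ι) :
    Measurable fun z : (ι → ℝ) × ℝ => Function.update z.1 i z.2 := by
  refine measurable_pi_lambda _ fun j => ?_
  by_cases h : j = i
  · subst h; simpa using measurable_snd
  · simp only [Function.update_of_ne h]
    exact (measurable_pi_apply j).comp measurable_fst

/-- Resampling one coordinate does not change a product law. -/
theorem map_update_infinitePi [DecidableEq ι] (i : ι) :
    ((Measure.infinitePi fun _ : ι => ν).prod ν).map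
      (fun z : (ι → ℝ) × ℝ => Function.update z.1 i z.2) = Measure.infinitePi fun _ : ι => ν := by
  have hm := measurable_update_pair (ι := ι) i
  refine Measure.eq_infinitePi _ fun s t ht => ?_
  rw [Measure.map_apply hm (.pi s.countable_toSet fun _ _ => ht _)]
  have : (fun z : (ι → ℝ) × ℝ => Function.update z.1 i z.2) ⁻¹' (s : Set ι).pi t =
      ((s.erase i : Finset ι) : Set ι).pi t ×ˢ (if i ∈ s then t i else Set.univ) := by
    ext ⟨J, u⟩
    simp only [Set.mem_preimage, Set.mem_pi, Set.mem_prod, Finset.mem_coe, Finset.mem_erase]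
    constructor
    · intro h
      refine ⟨fun j hj => ?_, ?_⟩
      · simpa [Function.update_of_ne hj.1] using h j hj.2
      · split_ifs with hi
        · simpa using h i hi
        · trivial
    · rintro ⟨h1, h2⟩ j hj
      by_cases hji : j = i
      · subst hji
        simpa [hj] using h2
      · simpa [Function.update_of_ne hji] using h1 j ⟨hji, hj⟩
  rw [this, Measure.prod_prod, Measure.infinitePi_pi _ fun j _ => ht j]
  by_cases hi : i ∈ s
  · rw [if_pos hi, Finset.prod_erase_mul _ _ hi]
  · rw [if_neg hi, measure_univ, mul_one, Finset.erase_eq_of_notMem hi]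

theorem lintegral_update_infinitePi [DecidableEq ι] (i : ι) {F : (ι → ℝ) → ENNReal}
    (hF : Measurable F) :
    ∫⁻ J, ∫⁻ u, F (Function.update J i u) ∂ν ∂(Measure.infinitePi fun _ : ι => ν) =
      ∫⁻ J, F J ∂(Measure.infinitePi fun _ : ι => ν) := by
  have hm := measurable_update_pair (ι := ι) i
  conv_rhs => rw [← map_update_infinitePi ν i, lintegral_map hF hm]
  exact (lintegral_prod _ (hF.comp hm).aemeasurable).symm

/-- A zero-one law: an event which almost surely is not affected by setting finitely many
coordinates to `1` is trivial. -/
theorem infinitePi_zero_or_one [Countable ι] [DecidableEq ι] {A : Set (ι → ℝ)}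
    (hA : MeasurableSet A)
    (hinv : ∀ᵐ J ∂(Measure.infinitePi fun _ : ι => ν), ∀ S : Finset ι,
      (S.piecewise (fun _ => (1 : ℝ)) J ∈ A ↔ J ∈ A)) :
    (∀ᵐ J ∂(Measure.infinitePi fun _ : ι => ν), J ∈ A) ∨
      ∀ᵐ J ∂(Measure.infinitePi fun _ : ι => ν), J ∉ A := by
  set P := Measure.infinitePi fun _ : ι => ν
  let s : ι → MeasurableSpace (ι → ℝ) := fun i =>
    MeasurableSpace.comap (fun J : ι → ℝ => J i) inferInstance
  let A' : Set (ι → ℝ) := {J | ∃ S₀ : Finset ι, ∀ S : Finset ι, S₀ ⊆ S →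
    S.piecewise (fun _ => (1 : ℝ)) J ∈ A}
  have hA' : ∀ᵐ J ∂P, (J ∈ A' ↔ J ∈ A) := by
    filter_upwards [hinv] with J hJ
    refine ⟨fun ⟨S₀, h⟩ => (hJ S₀).1 (h S₀ subset_rfl), fun h => ⟨∅, fun S _ => (hJ S).2 h⟩⟩
  have htail : MeasurableSet[limsup s cofinite] A' := by
    rw [limsup_eq_iInf_iSup, MeasurableSpace.measurableSet_iInf]
    intro U
    rw [MeasurableSpace.measurableSet_iInf]
    intro hU
    set m := ⨆ i ∈ U, s i with hm
    set S₁ : Finset ι := (mem_cofinite.1 hU).toFinset with hS₁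
    have hA'eq : A' = ⋃ S₀ : Finset ι, ⋂ S : Finset ι, ⋂ _ : S₀ ∪ S₁ ⊆ S,
        (fun J : ι → ℝ => S.piecewise (fun _ => (1 : ℝ)) J) ⁻¹' A := by
      ext J
      simp only [A', Set.mem_ofPred_eq, Set.mem_iUnion, Set.mem_iInter, Set.mem_preimage]
      exact ⟨fun ⟨S₀, h⟩ => ⟨S₀, fun S hS => h S (Finset.union_subset_left hS)⟩,
        fun ⟨S₀, h⟩ => ⟨S₀ ∪ S₁, h⟩⟩
    rw [hA'eq]
    refine MeasurableSet.iUnion fun S₀ => MeasurableSet.iInter fun S =>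
      MeasurableSet.iInter fun hS => ?_
    have hmeas : @Measurable _ _ m MeasurableSpace.pi
        fun J : ι → ℝ => S.piecewise (fun _ => (1 : ℝ)) J := by
      refine (@measurable_pi_iff (ι → ℝ) ι (fun _ => ℝ) m (fun _ => inferInstance) _).2
        fun i => ?_
      by_cases hi : i ∈ S
      · simp only [Finset.piecewise_eq_of_mem _ _ _ hi]
        exact @measurable_const _ _ _ m _
      · simp only [Finset.piecewise_eq_of_notMem _ _ _ hi]
        have hiU : i ∈ U := by
          by_contra hiU
          exact hi (hS (Finset.mem_union_right _ ((mem_cofinite.1 hU).mem_toFinset.2 hiU)))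
        have hle : s i ≤ m := le_iSup₂_of_le i hiU le_rfl
        exact Measurable.mono (comap_measurable _) hle le_rfl
    exact hmeas hA
  have hind : iIndep s P := by
    have := iIndepFun_infinitePi (P := fun _ : ι => ν) (X := fun _ => id) fun _ => measurable_id
    exact this
  have h01 : P A' = 0 ∨ P A' = 1 := by
    refine measure_zero_or_one_of_measurableSet_limsup (p := fun t : Set ι => t.Finite)
      (ns := fun S : Finset ι => (S : Set ι)) (f := cofinite) (s := s) ?_ hind ?_ ?_ ?_ ?_ htail
    · exact fun i => (measurable_pi_apply i).comap_le
    · intro t ht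
      rw [mem_cofinite, compl_compl]
      exact ht
    · exact fun S S' => ⟨S ∪ S', by simp, by simp⟩
    · exact fun S => S.finite_toSet
    · exact fun i => ⟨{i}, by simp⟩
  rcases h01 with h | h
  · right
    have : ∀ᵐ J ∂P, J ∉ A' := measure_eq_zero_iff_ae_notMem.1 h
    filter_upwards [this, hA'] with J h1 h2
    rwa [← h2]
  · left
    have hmA' : MeasurableSet A' := by
      have hle : limsup s cofinite ≤ (inferInstance : MeasurableSpace (ι → ℝ)) := by
        refine (limsup_le_iSup).trans (iSup_le fun i => (measurable_pi_apply i).comap_le)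
      exact hle _ htail
    have : ∀ᵐ J ∂P, J ∈ A' := (mem_ae_iff_prob_eq_one hmA').2 h
    filter_upwards [this, hA'] with J h1 h2
    rwa [← h2]

/-- Infinitely many i.i.d. variables with positive mass near `0` are not bounded away from `0`. -/
theorem ae_exists_abs_lt {i : ℕ → ι} (hi : Function.Injective i) {ε : ℝ}
    (hε : 0 < ν (Set.Ioo (-ε) ε)) :
    ∀ᵐ J ∂(Measure.infinitePi fun _ : ι => ν), ∃ n, |J (i n)| < ε := by
  classical
  set r := ν (Set.Ioo (-ε) ε)ᶜ with hr
  have hr1 : r < 1 := by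
    rw [hr, prob_compl_eq_one_sub measurableSet_Ioo]
    exact ENNReal.sub_lt_self ENNReal.one_ne_top one_ne_zero hε.ne'
  rw [ae_iff]
  refine le_antisymm ?_ zero_le
  refine ge_of_tendsto' (ENNReal.tendsto_pow_atTop_nhds_zero_of_lt_one hr1) fun N => ?_
  have h1 := Measure.infinitePi_pi (fun _ : ι => ν) (s := (Finset.range N).map ⟨i, hi⟩)
    (t := fun _ => (Set.Ioo (-ε) ε)ᶜ) fun _ _ => measurableSet_Ioo.compl
  rw [Finset.prod_const, Finset.card_map, Finset.card_range] at h1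
  rw [← hr] at h1
  rw [← h1]
  refine measure_mono fun J hJ => ?_
  simp only [Set.mem_ofPred_eq, not_exists, not_lt] at hJ
  intro j hj
  obtain ⟨n, -, rfl⟩ := Finset.mem_map.1 (Finset.mem_coe.1 hj)
  intro h
  exact (hJ n).not_gt (abs_lt.2 h)

end Product

namespace IsLinearGrowth

variable {ν : Measure ℝ} [IsProbabilityMeasure ν] (hν : IsLinearGrowth ν)

include hν

theorem exists_lower :
    ∃ c δ : ℝ, 0 < c ∧ 0 < δ ∧ ∀ t, 0 ≤ t →
      ENNReal.ofReal (c * min t δ) ≤ ν (Set.Ioo (-t) t) := by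
  obtain ⟨c, C, hc, hcC, h⟩ := hν
  obtain ⟨δ, hδ, h⟩ := mem_nhdsGT_iff_exists_Ioc_subset.1 h
  refine ⟨c, δ, hc, hδ, fun t ht => ?_⟩
  rcases ht.eq_or_lt with rfl | ht
  · rw [min_eq_left (le_of_lt hδ)]; simp
  have := (h (⟨lt_min ht hδ, min_le_right _ _⟩ : min t δ ∈ Set.Ioc 0 δ)).1
  refine (ENNReal.ofReal_le_ofReal this).trans ?_
  rw [ofReal_measureReal]
  refine measure_mono (Set.Ioo_subset_Ioo ?_ (min_le_left _ _))
  exact neg_le_neg (min_le_left _ _)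

theorem measure_Ioo_pos {ε : ℝ} (hε : 0 < ε) : 0 < ν (Set.Ioo (-ε) ε) := by
  obtain ⟨c, δ, hc, hδ, h⟩ := hν.exists_lower
  refine lt_of_lt_of_le ?_ (h ε hε.le)
  rw [ENNReal.ofReal_pos]
  exact mul_pos hc (lt_min hε hδ)

theorem measure_singleton_zero : ν {0} = 0 := by
  obtain ⟨c, C, hc, hcC, h⟩ := hν
  have hC : Tendsto (fun ε : ℝ => C * ε) (𝓝[>] 0) (𝓝 0) := by
    have : Tendsto (fun ε : ℝ => C * ε) (𝓝 0) (𝓝 (C * 0)) := by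
      exact (continuous_const.mul continuous_id).tendsto 0
    rw [mul_zero] at this
    exact this.mono_left nhdsWithin_le_nhds
  have h0 : ν.real {0} ≤ 0 := by
    refine ge_of_tendsto hC ?_
    filter_upwards [h, self_mem_nhdsWithin] with ε hε hpos
    refine le_trans (measureReal_mono ?_) hε.2
    rw [Set.singleton_subset_iff]
    exact ⟨neg_lt_zero.2 hpos, hpos⟩
  have h1 := le_antisymm h0 measureReal_nonneg
  rwa [measureReal_eq_zero_iff] at h1

theorem ae_ne_zero {ι : Type*} [Countable ι] :
    ∀ᵐ J ∂(Measure.infinitePi fun _ : ι => ν), ∀ i, J i ≠ 0 := by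
  rw [ae_all_iff]
  intro i
  have h1 : ∀ᵐ u ∂ν, u ≠ 0 := by
    rw [ae_iff]
    simpa using hν.measure_singleton_zero
  exact (measurePreserving_eval_infinitePi (fun _ : ι => ν) i).quasiMeasurePreserving.ae h1

end IsLinearGrowth

namespace RootedTree.Spans

variable {T : RootedTree V} {G : SimpleGraph V} (hT : T.Spans G)

include hT

theorem sum_onVertices_le [DecidableEq G.edgeSet] {κ : G.edgeSet → ℝ} (hκ : ∀ e, 0 ≤ κ e) {y : V}
    (hy : y ≠ T.root) {B W : Finset V}
    (hW : ∀ w ∈ W, w ≠ y ∧ ∃ hw : w ≠ T.root, hT.edgeAt w hw ∈ hT.boundary B) :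
    ∑ w ∈ W, hT.onVertices κ w ≤ ∑ e ∈ (hT.boundary B).erase (hT.edgeAt y hy), κ e := by
  let i : W ↪ G.edgeSet := ⟨fun w => hT.edgeAt w.1 (hW w.1 w.2).2.1,
    fun w w' h => Subtype.ext (hT.edgeAt_inj.1 h)⟩
  have h1 : ∑ w ∈ W, hT.onVertices κ w = ∑ e ∈ W.attach.map i, κ e := by
    rw [Finset.sum_map, ← Finset.sum_attach]
    exact Finset.sum_congr rfl fun w _ => hT.onVertices_of_ne κ (hW w.1 w.2).2.1
  rw [h1]
  refine Finset.sum_le_sum_of_subset_of_nonneg (fun e he => ?_) fun e _ _ => hκ e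
  obtain ⟨w, -, rfl⟩ := Finset.mem_map.1 he
  refine Finset.mem_erase.2 ⟨fun h => (hW w.1 w.2).1 ?_, (hW w.1 w.2).2.2⟩
  exact (hT.edgeAt_inj (hw := (hW w.1 w.2).2.1) (hw' := hy)).1 h

/-- Two flows in disjoint branches, one of them passing through the edge above `y`, bound from
below the capacity of all cuts containing that edge. -/
theorem min_le_sum_boundary_erase [DecidableEq G.edgeSet] {κ : G.edgeSet → ℝ}
    (hκ : ∀ e, 0 ≤ κ e) {θ : V → ℝ}
    (h0 : ∀ v, 0 ≤ θ v) (hle : ∀ v, θ v ≤ hT.onVertices κ v)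
    (hsum : ∀ v, θ v ≤ ∑ w ∈ T.ch v, θ w) (hdec : ∀ v, ∀ w ∈ T.ch v, θ w ≤ θ v)
    {u A A' y : V} (hA : A ∈ T.ch u) (hA' : A' ∈ T.ch u) (hne : A ≠ A') (hAy : T.IsDesc A y)
    (hy : y ≠ T.root) {B : Finset V} (hB : hT.edgeAt y hy ∈ hT.boundary B) :
    min (θ y) (θ A') ≤ ∑ e ∈ (hT.boundary B).erase (hT.edgeAt y hy), κ e := by
  have hcut : ∀ v, ∑ w ∈ T.cut v B, θ w ≤ ∑ w ∈ T.cut v B, hT.onVertices κ w := fun v =>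
    Finset.sum_le_sum fun w _ => hle w
  rw [hT.edgeAt_mem_boundary] at hB
  rcases hB with ⟨hyB, -⟩ | ⟨hyB, hpB⟩
  · refine (min_le_left _ _).trans ((T.le_sum_cut h0 hsum y B).trans ((hcut y).trans ?_))
    refine hT.sum_onVertices_le hκ hy fun w hw => ?_
    obtain ⟨h1, h2, h3⟩ := T.mem_cut.1 hw
    have hwy : w ≠ y := fun h => h2 (h ▸ hyB)
    have hwr := h1.ne_root T hy
    exact ⟨hwy, hwr, hT.edgeAt_mem_boundary.2 (Or.inr ⟨h2, h3.resolve_left hwy⟩)⟩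
  · have hA'r := T.ne_root_of_mem_ch hA'
    by_cases huB : u ∈ B
    · refine (min_le_right _ _).trans ((T.le_sum_cut h0 hsum A' B).trans ((hcut A').trans ?_))
      refine hT.sum_onVertices_le hκ hy fun w hw => ?_
      obtain ⟨h1, h2, h3⟩ := T.mem_cut.1 hw
      have hwy : w ≠ y := by
        rintro rfl
        exact T.not_isDesc_sibling hA hA' hne hAy h1
      refine ⟨hwy, h1.ne_root T hA'r, hT.edgeAt_mem_boundary.2 (Or.inr ⟨h2, ?_⟩)⟩
      rcases h3 with rfl | h3
      · rwa [T.par_of_mem_ch hA']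
      · exact h3
    · obtain ⟨w, hwr, hwB, hpwB, hwy, hθ⟩ : ∃ w, w ≠ T.root ∧ w ∈ B ∧ T.par w ∉ B ∧ w ≠ y ∧
          θ y ≤ θ w := by
        obtain ⟨m, hm⟩ := hAy
        have hex : ∃ n, T.par^[n] (T.par y) ∉ B := by
          refine ⟨m, ?_⟩
          rw [← Function.iterate_succ_apply, Function.iterate_succ_apply', hm,
            T.par_of_mem_ch hA]
          exact huB
        classical
        obtain ⟨n, hn⟩ : ∃ n, Nat.find hex = n + 1 :=
          Nat.exists_eq_succ_of_ne_zero fun h => by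
            have := Nat.find_spec hex
            rw [h] at this
            exact this hpB
        have h1 : T.par^[n] (T.par y) ∈ B := by
          by_contra h
          have := Nat.find_min' hex h
          omega
        have h2 : T.par (T.par^[n] (T.par y)) ∉ B := by
          have := Nat.find_spec hex
          rwa [hn, Function.iterate_succ_apply'] at this
        have hθ : ∀ v, θ v ≤ θ (T.par v) := fun v => by
          by_cases hv : v = T.root
          · rw [hv, T.par_root]
          · exact hdec _ _ (T.mem_ch_par hv)
        refine ⟨_, ?_, h1, h2, ?_, ?_⟩
        · intro h
          rw [h, T.par_root] at h2
          exact h2 (h ▸ h1)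
        · intro h
          have h3 := T.depth_iterate_le (T.par y) n
          have h4 := T.depth_par y hy
          rw [h] at h3
          omega
        · have : ∀ n v, θ v ≤ θ (T.par^[n] v) := by
            intro n
            induction n with
            | zero => exact fun v => le_rfl
            | succ n ih => exact fun v => (hθ v).trans (ih _)
          exact (hθ y).trans (this n _)
      refine (min_le_left _ _).trans (hθ.trans ((hle w).trans ?_))
      rw [← Finset.sum_singleton (hT.onVertices κ) w]
      refine hT.sum_onVertices_le hκ hy fun w' hw' => ?_
      obtain rfl := Finset.mem_singleton.1 hw'
      exact ⟨hwy, hwr, hT.edgeAt_mem_boundary.2 (Or.inl ⟨hwB, hpwB⟩)⟩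

/-- The coupling on `e` is at most the capacity of the remaining edges of every cut through `e`. -/
def IsDominated (J : G.edgeSet → ℝ) (e : G.edgeSet) : Prop :=
  ∀ B : Finset V, e ∈ hT.boundary B → 2 * |J e| ≤ ∑ e' ∈ hT.boundary B, |J e'|

theorem isDominated_update_iff [DecidableEq G.edgeSet] (J : G.edgeSet → ℝ) (e : G.edgeSet)
    (u : ℝ) : hT.IsDominated (Function.update J e u) e ↔
      ∀ B : Finset V, e ∈ hT.boundary B → |u| ≤ ∑ e' ∈ (hT.boundary B).erase e, |J e'| := by
  refine forall_congr' fun B => forall_congr' fun he => ?_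
  rw [← Finset.add_sum_erase _ _ he, Function.update_self, two_mul, add_le_add_iff_left]
  rw [Finset.sum_congr rfl fun e' he' => by rw [Function.update_of_ne (Finset.ne_of_mem_erase he')]]

theorem isDominated_of_update [DecidableEq G.edgeSet] {J : G.edgeSet → ℝ} {e e' : G.edgeSet}
    {u : ℝ} (hJ : ¬ hT.IsDominated J e) (he : hT.IsDominated (Function.update J e u) e)
    (hne : e' ≠ e) (he' : hT.IsDominated (Function.update J e u) e') : hT.IsDominated J e' := by
  have hu : |u| ≤ |J e| := by
    rw [← Function.update_eq_self e J, hT.isDominated_update_iff] at hJ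
    push Not at hJ
    obtain ⟨B, hB, h⟩ := hJ
    exact ((hT.isDominated_update_iff J e u).1 he B hB).trans h.le
  intro B hB
  have := he' B hB
  rw [Function.update_of_ne hne] at this
  refine this.trans (Finset.sum_le_sum fun f _ => ?_)
  by_cases hf : f = e
  · subst hf; simpa using hu
  · rw [Function.update_of_ne hf]

theorem exists_isGroundState_of_isDominated {J : G.edgeSet → ℝ} (hJ : ∀ e, J e ≠ 0)
    {e : G.edgeSet} (he : hT.IsDominated J e) :
    ∃ σ, IsGroundState G J σ ∧ ∀ e', J e' * spinProd σ e' < 0 ↔ e' = e := by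
  classical
  obtain ⟨σ, hσ⟩ := hT.exists_spinProd_eq fun e' =>
    (if e' = e then -1 else 1) * (if J e' < 0 then -1 else 1)
  have hval : ∀ e', J e' * spinProd σ e' = if e' = e then -|J e'| else |J e'| := by
    intro e'
    rw [hσ]
    by_cases h2 : J e' < 0
    · rw [if_pos h2, abs_of_neg h2]
      split_ifs <;> simp
    · rw [if_neg h2, abs_of_nonneg (not_lt.1 h2)]
      split_ifs <;> simp
  refine ⟨σ, (hT.isGroundState_iff J σ).2 fun B => ?_, fun e' => ?_⟩
  · rw [Finset.sum_congr rfl fun e' _ => hval e']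
    by_cases heB : e ∈ hT.boundary B
    · have h := he B heB
      rw [← Finset.add_sum_erase _ _ heB] at h ⊢
      rw [if_pos rfl, Finset.sum_congr rfl fun e' he' => if_neg (Finset.ne_of_mem_erase he')]
      linarith
    · refine Finset.sum_nonneg fun e' he' => ?_
      rw [if_neg (by rintro rfl; exact heB he')]
      exact abs_nonneg _
  · rw [hval]
    split_ifs with h
    · simp [h, hJ e]
    · simp [h]

theorem infinite_groundStates {J : G.edgeSet → ℝ} (hJ : ∀ e, J e ≠ 0)
    (h : {e | hT.IsDominated J e}.Infinite) : (groundStates G J).Infinite := by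
  have h1 : ∀ e, ∃ σ, hT.IsDominated J e →
      IsGroundState G J σ ∧ ∀ e', J e' * spinProd σ e' < 0 ↔ e' = e := fun e => by
    by_cases he : hT.IsDominated J e
    · obtain ⟨σ, hσ⟩ := hT.exists_isGroundState_of_isDominated hJ he
      exact ⟨σ, fun _ => hσ⟩
    · exact ⟨1, fun h => absurd h he⟩
  choose σ hσ using h1
  refine Set.infinite_of_injOn_mapsTo (f := σ) (fun e he e' he' hee => ?_)
    (fun e he => (hσ e he).1) h
  have := ((hσ e he).2 e).2 rfl
  rw [hee] at this
  exact ((hσ e' he').2 e).1 this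

theorem spinProd_pos_of_flowTo_eq_zero {J : G.edgeSet → ℝ} (hJ : ∀ e, J e ≠ 0)
    (h : T.flowTo (hT.onVertices fun e => |J e|) T.root = 0) {σ : V → ℤˣ}
    (hσ : IsGroundState G J σ) (e : G.edgeSet) : 0 < J e * spinProd σ e := by
  classical
  have hk := hT.onVertices_pos fun e => abs_pos.2 (hJ e)
  have hk' := fun v => (hk v).le
  have hge : ∀ e : G.edgeSet, J e * spinProd σ e ≤ |J e| := fun e => by
    rcases spinProd_eq_one_or σ e with h | h <;> rw [h]
    · rw [mul_one]; exact le_abs_self _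
    · rw [mul_neg_one]; exact neg_le_abs _
  obtain ⟨y, hy, rfl⟩ := hT.exists_edgeAt e
  by_contra hneg
  have hval : J (hT.edgeAt y hy) * spinProd σ (hT.edgeAt y hy) = -|J (hT.edgeAt y hy)| := by
    rcases spinProd_eq_one_or σ (hT.edgeAt y hy) with h | h <;> rw [h] at hneg ⊢
    · rw [mul_one] at hneg ⊢
      rw [abs_of_nonpos (not_lt.1 hneg), neg_neg]
    · rw [mul_neg_one] at hneg ⊢
      rw [abs_of_nonneg (by linarith)]
  have hn : ∀ n, |J (hT.edgeAt y hy)| ≤ T.trunc (hT.onVertices fun e => |J e|) n y := by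
    intro n
    obtain ⟨B, hBd, hBp, hB⟩ := T.exists_cut_le_trunc hk' n y
    refine le_trans ?_ hB
    by_cases hyB : y ∈ B
    · have hpy : T.par y ∉ B := fun h => T.not_isDesc_par hy (hBd _ h)
      have hyb : hT.edgeAt y hy ∈ hT.boundary B := hT.edgeAt_mem_boundary.2 (Or.inl ⟨hyB, hpy⟩)
      have h1 := (hT.isGroundState_iff J σ).1 hσ B
      rw [← Finset.add_sum_erase _ _ hyb, hval] at h1
      have h2 : ∑ e ∈ (hT.boundary B).erase (hT.edgeAt y hy), J e * spinProd σ e ≤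
          ∑ e ∈ (hT.boundary B).erase (hT.edgeAt y hy), |J e| :=
        Finset.sum_le_sum fun e _ => hge e
      refine le_trans (by linarith : _ ≤ ∑ e ∈ (hT.boundary B).erase (hT.edgeAt y hy), |J e|) ?_
      have h3 : ∀ e ∈ (hT.boundary B).erase (hT.edgeAt y hy),
          ∃ w, w ∈ T.cut y B ∧ ∃ hw : w ≠ T.root, e = hT.edgeAt w hw := by
        intro e he
        obtain ⟨hne, heb⟩ := Finset.mem_erase.1 he
        obtain ⟨w, hw, rfl⟩ := hT.exists_edgeAt e
        refine ⟨w, ?_, hw, rfl⟩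
        have hwy : w ≠ y := fun h => hne (hT.edgeAt_inj.2 h)
        rcases hT.edgeAt_mem_boundary.1 heb with ⟨h1, h2⟩ | ⟨h1, h2⟩
        · exact absurd (hBp w h1 hwy) h2
        · exact T.mem_cut.2 ⟨IsDesc.of_par T (hBd _ h2), h1, Or.inr h2⟩
      have : Nonempty V := ⟨y⟩
      choose! w hwc hew using h3
      refine le_trans (le_of_eq ?_) (Finset.sum_le_sum_of_subset_of_nonneg
        (s := ((hT.boundary B).erase (hT.edgeAt y hy)).image w) (fun v hv => ?_)
        fun v _ _ => hk' v)
      · rw [Finset.sum_image]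
        · refine Finset.sum_congr rfl fun e he => ?_
          obtain ⟨h1, h2⟩ := hew e he
          rw [hT.onVertices_of_ne _ h1, ← h2]
        · intro e he e' he' hee
          obtain ⟨h1, h2⟩ := hew e he
          obtain ⟨h1', h2'⟩ := hew e' he'
          rw [h2, h2']
          exact hT.edgeAt_inj.2 hee
      · obtain ⟨e, he, rfl⟩ := Finset.mem_image.1 hv
        exact hwc e he
    · rw [← hT.onVertices_of_ne (fun e => |J e|) hy]
      exact Finset.single_le_sum (f := hT.onVertices fun e => |J e|) (fun w _ => hk' w)
        (T.mem_cut.2 ⟨T.isDesc_refl y, hyB, Or.inl rfl⟩)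
  have hpos : 0 < T.flowTo (hT.onVertices fun e => |J e|) y :=
    (abs_pos.2 (hJ _)).trans_le (le_ciInf hn)
  have := T.flowTo_pos_iterate hk hpos (T.depth y)
  rw [T.iterate_depth, h] at this
  exact this.false

theorem encard_groundStates_eq_two {J : G.edgeSet → ℝ} (hJ : ∀ e, J e ≠ 0)
    (h : T.flowTo (hT.onVertices fun e => |J e|) T.root = 0) : (groundStates G J).encard = 2 := by
  classical
  obtain ⟨τ, hτ⟩ := hT.exists_spinProd_eq fun e => if J e < 0 then -1 else 1
  have hτJ : ∀ e, 0 ≤ J e * spinProd τ e := by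
    intro e
    rw [hτ]
    split_ifs with h
    · simpa using h.le
    · simpa using h
  have hneg : ∀ z, spinProd (-τ) z = spinProd τ z := by
    intro z
    induction z with
    | _ x y => simp [spinProd]
  have hset : groundStates G J = {τ, -τ} := by
    ext σ
    constructor
    · intro hσ
      have hpos := hT.spinProd_pos_of_flowTo_eq_zero hJ h hσ
      have heq : ∀ e : G.edgeSet, spinProd σ e = spinProd τ e := by
        intro e
        have h1 := hpos e
        have h2 := hτJ e
        rcases spinProd_eq_one_or σ e with h | h <;> rcases spinProd_eq_one_or τ e with h' | h' <;>
          rw [h, h'] <;> rw [h] at h1 <;> rw [h'] at h2 <;> linarith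
      have hq : ∀ v, σ v * τ v = σ T.root * τ T.root := by
        intro v
        induction hd : T.depth v generalizing v with
        | zero => rw [T.root_of_depth_eq_zero hd]
        | succ n ih =>
          have hv : v ≠ T.root := by rintro rfl; rw [T.depth_root] at hd; omega
          rw [← ih (T.par v) (by have := T.depth_par v hv; omega)]
          have := heq (hT.edgeAt v hv)
          simp only [spinProd, edgeAt, Sym2.lift_mk] at this
          have h1 : σ (T.par v) * σ v = τ (T.par v) * τ v := by
            ext
            push_cast
            exact_mod_cast this
          have h2 : σ v = σ (T.par v) * (τ (T.par v) * τ v) := by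
            rw [← h1, ← mul_assoc, Int.units_mul_self, one_mul]
          rw [h2, mul_assoc, mul_assoc, Int.units_mul_self, mul_one]
      rcases Int.units_eq_one_or (σ T.root * τ T.root) with hr | hr
      · left
        funext v
        have := hq v
        rw [hr] at this
        rw [← mul_one (σ v), ← Int.units_mul_self (τ v), ← mul_assoc, this, one_mul]
      · right
        funext v
        have := hq v
        rw [hr] at this
        rw [← mul_one (σ v), ← Int.units_mul_self (τ v), ← mul_assoc, this]
        simp
    · rintro (rfl | rfl)
      · exact (hT.isGroundState_iff J _).2 fun B => Finset.sum_nonneg fun e _ => hτJ e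
      · refine (hT.isGroundState_iff J _).2 fun B => Finset.sum_nonneg fun e _ => ?_
        rw [hneg]
        exact hτJ e
  rw [hset, Set.encard_pair]
  intro h
  have := congrFun h T.root
  rcases Int.units_eq_one_or (τ T.root) with h1 | h1 <;> simp [h1] at this

end RootedTree.Spans

theorem exists_pos_mul_le {ι : Type*} {κ κ' : ι → ℝ} (hκ : ∀ i, 0 < κ i) (hκ' : ∀ i, 0 < κ' i)
    (S : Finset ι) : ∃ c : ℝ, 0 < c ∧ c ≤ 1 ∧ ∀ i ∈ S, c * κ' i ≤ κ i := by
  classical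
  induction S using Finset.induction_on with
  | empty => exact ⟨1, one_pos, le_rfl, by simp⟩
  | insert a S _ ih =>
    obtain ⟨c, hc, hc1, h⟩ := ih
    refine ⟨min c (κ a / κ' a), lt_min hc (div_pos (hκ a) (hκ' a)),
      (min_le_left _ _).trans hc1, fun i hi => ?_⟩
    rcases Finset.mem_insert.1 hi with rfl | hi
    · exact (mul_le_mul_of_nonneg_right (min_le_right _ _) (hκ' i).le).trans
        (div_mul_cancel₀ _ (hκ' i).ne').le
    · exact (mul_le_mul_of_nonneg_right (min_le_left _ _) (hκ' i).le).trans (h i hi)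

theorem RootedTree.countable_edgeSet (T : RootedTree V) (G : SimpleGraph V) :
    Countable G.edgeSet := by
  have := T.countable_vertices
  infer_instance

namespace RootedTree.Spans

variable {T : RootedTree V} {G : SimpleGraph V} (hT : T.Spans G)

include hT

theorem flowTo_pos_of_eq_off_finset {κ κ' : G.edgeSet → ℝ} (hκ : ∀ e, 0 < κ e)
    (hκ' : ∀ e, 0 < κ' e) {S : Finset G.edgeSet} (h : ∀ e, e ∉ S → κ e = κ' e) {v : V}
    (hv : 0 < T.flowTo (hT.onVertices κ') v) : 0 < T.flowTo (hT.onVertices κ) v := by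
  classical
  obtain ⟨c, hc, hc1, hcS⟩ := exists_pos_mul_le hκ hκ' S
  refine (mul_pos hc hv).trans_le
    (T.mul_flowTo_le hc.le (hT.onVertices_nonneg fun e => (hκ' e).le) (fun w => ?_) v)
  by_cases hw : w = T.root
  · rw [hw, hT.onVertices_root, hT.onVertices_root, mul_one]
    exact hc1
  · rw [hT.onVertices_of_ne _ hw, hT.onVertices_of_ne _ hw]
    by_cases he : hT.edgeAt w hw ∈ S
    · exact hcS _ he
    · rw [h _ he]
      exact mul_le_of_le_one_left (hκ' _).le hc1

theorem measurable_flowTo (v : V) :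
    Measurable fun J : G.edgeSet → ℝ => T.flowTo (hT.onVertices fun e => |J e|) v := by
  have h1 : ∀ w, Measurable fun J : G.edgeSet → ℝ => hT.onVertices (fun e => |J e|) w := by
    intro w
    by_cases hw : w = T.root
    · simp only [hw, hT.onVertices_root]
      exact measurable_const
    · simp only [hT.onVertices_of_ne _ hw]
      exact (measurable_pi_apply _).abs
  have h2 : ∀ n w, Measurable fun J : G.edgeSet → ℝ =>
      T.trunc (hT.onVertices fun e => |J e|) n w := by
    intro n
    induction n with
    | zero => exact h1
    | succ n ih => exact fun w => (h1 w).min (Finset.measurable_fun_sum _ fun u _ => ih u)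
  refine measurable_of_tendsto_metrizable (fun n => h2 n v) (tendsto_pi_nhds.2 fun J => ?_)
  exact T.tendsto_trunc (hT.onVertices_nonneg fun e => abs_nonneg _) v

theorem measurableSet_isDominated (e : G.edgeSet) : MeasurableSet {J | hT.IsDominated J e} := by
  have := T.countable_vertices
  simp only [IsDominated, Set.ofPred_forall]
  refine MeasurableSet.iInter fun B => MeasurableSet.iInter fun _ => measurableSet_le ?_ ?_
  · exact (measurable_pi_apply e).abs.const_mul 2
  · exact Finset.measurable_fun_sum _ fun e' _ => (measurable_pi_apply e').abs

variable {ν : Measure ℝ} [IsProbabilityMeasure ν] (hν : IsLinearGrowth ν)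

include hν

theorem flowTo_pos_zero_or_one (v : V) :
    (∀ᵐ J ∂couplingLaw G ν, 0 < T.flowTo (hT.onVertices fun e => |J e|) v) ∨
      ∀ᵐ J ∂couplingLaw G ν, ¬ 0 < T.flowTo (hT.onVertices fun e => |J e|) v := by
  classical
  have := T.countable_edgeSet G
  refine infinitePi_zero_or_one ν
    (A := {J | 0 < T.flowTo (hT.onVertices fun e => |J e|) v})
    (measurableSet_lt measurable_const (hT.measurable_flowTo v)) ?_
  filter_upwards [hν.ae_ne_zero] with J hJ S
  have h1 : ∀ e, 0 < |J e| := fun e => abs_pos.2 (hJ e)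
  have h2 : ∀ e, 0 < |S.piecewise (fun _ => (1 : ℝ)) J e| := fun e => by
    by_cases he : e ∈ S
    · simp [he]
    · simp [he, hJ e]
  have h3 : ∀ e, e ∉ S → |S.piecewise (fun _ => (1 : ℝ)) J e| = |J e| := fun e he => by
    simp [he]
  exact ⟨hT.flowTo_pos_of_eq_off_finset h1 h2 fun e he => (h3 e he).symm,
    hT.flowTo_pos_of_eq_off_finset h2 h1 h3⟩

theorem exists_branching
    (h : ∀ᵐ J ∂couplingLaw G ν, 0 < T.flowTo (hT.onVertices fun e => |J e|) T.root) :
    ∃ u, ∃ A ∈ T.ch u, ∃ A' ∈ T.ch u, A ≠ A' ∧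
      (∀ᵐ J ∂couplingLaw G ν, 0 < T.flowTo (hT.onVertices fun e => |J e|) A) ∧
      ∀ᵐ J ∂couplingLaw G ν, 0 < T.flowTo (hT.onVertices fun e => |J e|) A' := by
  classical
  have := T.countable_vertices
  let D : V → Prop := fun v =>
    ∀ᵐ J ∂couplingLaw G ν, 0 < T.flowTo (hT.onVertices fun e => |J e|) v
  by_contra hno
  have hno' : ∀ u, ∀ A ∈ T.ch u, ∀ A' ∈ T.ch u, D A → D A' → A = A' := by
    intro u A hA A' hA' h1 h2
    by_contra hne
    exact hno ⟨u, A, hA, A', hA', hne, h1, h2⟩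
  have hk : ∀ J : G.edgeSet → ℝ, ∀ w, 0 ≤ hT.onVertices (fun e => |J e|) w :=
    fun J => hT.onVertices_nonneg fun e => abs_nonneg _
  have hD : ∀ᵐ J ∂couplingLaw G ν, ∀ v, ¬ D v →
      T.flowTo (hT.onVertices fun e => |J e|) v = 0 := by
    rw [ae_all_iff]
    intro v
    by_cases hv : D v
    · exact Eventually.of_forall fun J h => absurd hv h
    · filter_upwards [(hT.flowTo_pos_zero_or_one hν v).resolve_left hv] with J hJ _
      exact le_antisymm (not_lt.1 hJ) (T.flowTo_nonneg (hk J) v)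
  have hnext : ∀ v, ∃ w, D v → w ∈ T.ch v ∧ D w := by
    intro v
    by_cases hv : D v
    · obtain ⟨J, h1, h2⟩ := (hv.and hD).exists
      have h3 := h1.trans_le (T.flowTo_le_sum (hk J) v)
      obtain ⟨w, hw, hw0⟩ := Finset.exists_ne_zero_of_sum_ne_zero h3.ne'
      exact ⟨w, fun _ => ⟨hw, by_contra fun hwD => hw0 (h2 w hwD)⟩⟩
    · exact ⟨v, fun h => absurd h hv⟩
  choose nxt hnxt using hnext
  let r : ℕ → V := fun n => nxt^[n] T.root
  have hrD : ∀ n, D (r n) := by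
    intro n
    induction n with
    | zero => exact h
    | succ n ih =>
      simp only [r, Function.iterate_succ_apply']
      exact (hnxt _ ih).2
  have hrch : ∀ n, r (n + 1) ∈ T.ch (r n) := fun n => by
    simp only [r, Function.iterate_succ_apply']
    exact (hnxt _ (hrD n)).1
  have hdepth : ∀ n, T.depth (r n) = n := by
    intro n
    induction n with
    | zero => exact T.depth_root
    | succ n ih => rw [T.depth_of_mem_ch (hrch n), ih]
  have hle : ∀ᵐ J ∂couplingLaw G ν, ∀ n, T.flowTo (hT.onVertices fun e => |J e|) T.root ≤
      T.flowTo (hT.onVertices fun e => |J e|) (r n) := by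
    filter_upwards [hD] with J hJ n
    induction n with
    | zero => exact le_rfl
    | succ n ih =>
      refine ih.trans ((T.flowTo_le_sum (hk J) _).trans_eq ?_)
      refine Finset.sum_eq_single_of_mem _ (hrch n) fun w hw hne => hJ w fun hwD => hne ?_
      exact hno' _ _ hw _ (hrch n) hwD (hrD _)
  let i : ℕ → G.edgeSet := fun n => hT.edgeAt (r (n + 1)) (T.ne_root_of_mem_ch (hrch n))
  have hi : Function.Injective i := fun n m hnm => by
    have h1 := hT.edgeAt_inj.1 hnm
    have h2 := congrArg T.depth h1
    rw [hdepth, hdepth] at h2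
    omega
  have hsmall : ∀ᵐ J ∂couplingLaw G ν, ∀ m : ℕ, ∃ n, |J (i n)| < 1 / ((m : ℝ) + 1) :=
    ae_all_iff.2 fun m => ae_exists_abs_lt ν hi (hν.measure_Ioo_pos (by positivity))
  obtain ⟨J, h1, h2, h3⟩ := (h.and (hle.and hsmall)).exists
  obtain ⟨m, hm⟩ := exists_nat_one_div_lt h1
  obtain ⟨n, hn⟩ := h3 m
  have h4 := (h2 (n + 1)).trans (T.flowTo_le (hk J) _)
  rw [hT.onVertices_of_ne _ (T.ne_root_of_mem_ch (hrch n))] at h4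
  exact absurd (h4.trans_lt (hn.trans hm)) (lt_irrefl _)

theorem tsum_measure_isDominated_update_eq_top [DecidableEq G.edgeSet] {J : G.edgeSet → ℝ}
    (hJ : ∀ e, J e ≠ 0) {u A A' : V} (hA : A ∈ T.ch u) (hA' : A' ∈ T.ch u) (hne : A ≠ A')
    (hAJ : 0 < T.flowTo (hT.onVertices fun e => |J e|) A)
    (hAJ' : 0 < T.flowTo (hT.onVertices fun e => |J e|) A') :
    ∑' e, ν {t | hT.IsDominated (Function.update J e t) e} = ⊤ := by
  have hκ : ∀ e, 0 ≤ |J e| := fun e => abs_nonneg _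
  have hkpos := hT.onVertices_pos fun e => abs_pos.2 (hJ e)
  have hk := fun v => (hkpos v).le
  obtain ⟨θ, h0, hle, hsum, hdec, hpos⟩ :=
    T.exists_decreasing_superflow (T.flowTo_nonneg hk) (T.flowTo_le_sum hk)
  have hθA := hpos A (T.flowTo_pos_iterate hkpos hAJ)
  have hθA' := hpos A' (T.flowTo_pos_iterate hkpos hAJ')
  obtain ⟨c, δ, hc, hδ, hcδ⟩ := hν.exists_lower
  set b := min (θ A') δ with hb
  have hbpos : 0 < b := lt_min hθA' hδ
  let g : V → ℝ := fun v => c * min b (θ v)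
  have hg : ∀ v, g v ≤ ∑ w ∈ T.ch v, g w := fun v => by
    simp only [g]
    rw [← Finset.mul_sum]
    exact mul_le_mul_of_nonneg_left ((min_le_min le_rfl (hsum v)).trans
      (min_sum_le _ h0 hbpos.le)) hc.le
  have hg0 : ∀ v, 0 ≤ g v := fun v => mul_nonneg hc.le (le_min hbpos.le (h0 v))
  have hgA : 0 < g A := mul_pos hc (lt_min hbpos hθA)
  have hAr := T.ne_root_of_mem_ch hA
  have hq : ∀ y (hAy : T.IsDesc A y), ENNReal.ofReal (g y) ≤
      ν {t | hT.IsDominated (Function.update J (hT.edgeAt y (hAy.ne_root T hAr)) t)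
        (hT.edgeAt y (hAy.ne_root T hAr))} := by
    intro y hAy
    have : g y = c * min (min (θ y) (θ A')) δ := by
      simp only [g, hb]
      rw [min_comm, min_assoc]
    rw [this]
    refine (hcδ _ (le_min (h0 y) (h0 A'))).trans (measure_mono fun t ht => ?_)
    refine (hT.isDominated_update_iff J _ t).2 fun B hB => ?_
    exact (abs_lt.2 ht).le.trans (hT.min_le_sum_boundary_erase hκ h0
      (fun v => (hle v).trans (T.flowTo_le hk v)) hsum hdec hA hA' hne hAy _ hB)
  have hn : ∀ n : ℕ, (n : ENNReal) * ENNReal.ofReal (g A) ≤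
      ∑' e, ν {t | hT.IsDominated (Function.update J e t) e} := by
    intro n
    obtain ⟨F, hF, hFg⟩ := T.exists_finset_le_sum hg A n
    calc (n : ENNReal) * ENNReal.ofReal (g A) = ENNReal.ofReal (n * g A) := by
          rw [ENNReal.ofReal_mul (Nat.cast_nonneg n), ENNReal.ofReal_natCast]
      _ ≤ ENNReal.ofReal (∑ w ∈ F, g w) := ENNReal.ofReal_le_ofReal hFg
      _ = ∑ w ∈ F, ENNReal.ofReal (g w) := ENNReal.ofReal_sum_of_nonneg fun w _ => hg0 w
      _ = ∑' w : F, ENNReal.ofReal (g w) := by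
          rw [← Finset.sum_attach, tsum_fintype]; rfl
      _ ≤ ∑' w : F, ν {t | hT.IsDominated
            (Function.update J (hT.edgeAt w.1 ((hF w.1 w.2).ne_root T hAr)) t)
            (hT.edgeAt w.1 ((hF w.1 w.2).ne_root T hAr))} :=
          ENNReal.tsum_le_tsum fun w => hq w.1 (hF w.1 w.2)
      _ ≤ _ := ENNReal.tsum_comp_le_tsum_of_injective
          (f := fun w : F => hT.edgeAt w.1 ((hF w.1 w.2).ne_root T hAr))
          (fun w w' hww => Subtype.ext (hT.edgeAt_inj.1 hww))
          fun e => ν {t | hT.IsDominated (Function.update J e t) e}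
  have hlim := ENNReal.Tendsto.mul_const (b := ENNReal.ofReal (g A))
    ENNReal.tendsto_nat_nhds_top (Or.inl ENNReal.top_ne_zero)
  rw [ENNReal.top_mul (ENNReal.ofReal_pos.2 hgA).ne'] at hlim
  exact top_le_iff.1 (le_of_tendsto' hlim hn)

open Classical in
theorem ae_infinite_isDominated
    (h : ∀ᵐ J ∂couplingLaw G ν, 0 < T.flowTo (hT.onVertices fun e => |J e|) T.root) :
    ∀ᵐ J ∂couplingLaw G ν, {e | hT.IsDominated J e}.Infinite := by
  have := T.countable_edgeSet G
  obtain ⟨u, A, hA, A', hA', hne, hpos, hpos'⟩ := hT.exists_branching hν h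
  let X : G.edgeSet → Set (G.edgeSet → ℝ) := fun e => {J | hT.IsDominated J e}
  have hX : ∀ e, MeasurableSet (X e) := hT.measurableSet_isDominated
  let N : (G.edgeSet → ℝ) → ENNReal := fun J => ∑' e, (X e).indicator 1 J
  have hN : Measurable N := Measurable.tsum fun e => measurable_one.indicator (hX e)
  have hupd : ∀ e, Measurable fun z : (G.edgeSet → ℝ) × ℝ => Function.update z.1 e z.2 :=
    fun e => measurable_update_pair e
  have hq : ∀ e, Measurable fun J : G.edgeSet → ℝ =>
      ν {t | hT.IsDominated (Function.update J e t) e} := fun e =>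
    measurable_measure_prodMk_left (hupd e (hX e))
  have key : ∀ k : ℕ, ∀ᵐ J ∂couplingLaw G ν, ¬ N J ≤ k := by
    intro k
    let Y : G.edgeSet → Set (G.edgeSet → ℝ) := fun e => {J | N J ≤ k} \ X e
    have hY : ∀ e, MeasurableSet (Y e) := fun e =>
      (measurableSet_le hN measurable_const).diff (hX e)
    let H : (G.edgeSet → ℝ) → ENNReal := fun J =>
      ∑' e, (Y e).indicator (fun J => ν {t | hT.IsDominated (Function.update J e t) e}) J
    have hH : Measurable H := Measurable.tsum fun e => (hq e).indicator (hY e)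
    have hstep : ∀ e, ∫⁻ J, (Y e).indicator
          (fun J => ν {t | hT.IsDominated (Function.update J e t) e}) J ∂couplingLaw G ν ≤
        ∫⁻ J, ({J | N J ≤ k + 1} ∩ X e).indicator 1 J ∂couplingLaw G ν := by
      intro e
      have hZ : MeasurableSet ({J | N J ≤ k + 1} ∩ X e) :=
        (measurableSet_le hN measurable_const).inter (hX e)
      rw [← lintegral_update_infinitePi ν e (measurable_one.indicator hZ)]
      refine lintegral_mono fun J => ?_
      by_cases hJ : J ∈ Y e
      · rw [Set.indicator_of_mem hJ]
        have hm : Measurable fun t : ℝ => Function.update J e t :=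
          (hupd e).comp measurable_prodMk_left
        refine (lintegral_indicator_one (hm (hX e))).symm.trans_le (lintegral_mono fun t => ?_)
        by_cases ht : Function.update J e t ∈ X e
        · rw [Set.indicator_of_mem (Set.mem_preimage.2 ht), Set.indicator_of_mem]
          · rfl
          refine ⟨?_, ht⟩
          have h1 : N (Function.update J e t) ≤ N J + 1 := by
            have h2 : ∑' e', (if e' = e then (1 : ENNReal) else 0) = 1 := tsum_ite_eq e _
            rw [← h2]
            simp only [N]
            rw [← ENNReal.tsum_add]
            refine ENNReal.tsum_le_tsum fun e' => ?_
            by_cases hee : e' = e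
            · rw [if_pos hee]
              exact (Set.indicator_le_self' (fun _ _ => zero_le) _).trans le_add_self
            · rw [if_neg hee, add_zero]
              by_cases he' : Function.update J e t ∈ X e'
              · have : J ∈ X e' := hT.isDominated_of_update hJ.2 ht hee he'
                rw [Set.indicator_of_mem he', Set.indicator_of_mem this]
                rfl
              · rw [Set.indicator_of_notMem he']
                exact zero_le
          exact h1.trans (add_le_add hJ.1 le_rfl)
        · rw [Set.indicator_of_notMem (fun h => ht (Set.mem_preimage.1 h))]
          exact zero_le
      · rw [Set.indicator_of_notMem hJ]
        exact zero_le
    have hHle : ∫⁻ J, H J ∂couplingLaw G ν ≤ k + 1 := by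
      simp only [H]
      rw [lintegral_tsum fun e => ((hq e).indicator (hY e)).aemeasurable]
      refine (ENNReal.tsum_le_tsum hstep).trans ?_
      rw [← lintegral_tsum fun e => (measurable_one.indicator
        ((measurableSet_le hN measurable_const).inter (hX e))).aemeasurable]
      have hpt : ∀ J, ∑' e, ({J | N J ≤ k + 1} ∩ X e).indicator (1 : (G.edgeSet → ℝ) → ENNReal) J ≤
          (k : ENNReal) + 1 := by
        intro J
        by_cases hJ : N J ≤ k + 1
        · refine le_trans (ENNReal.tsum_le_tsum fun e => ?_) hJ
          exact Set.indicator_le_indicator_of_subset Set.inter_subset_right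
            (fun _ => zero_le) J
        · refine le_trans (le_of_eq ?_) zero_le
          rw [ENNReal.tsum_eq_zero]
          exact fun e => Set.indicator_of_notMem (fun h => hJ h.1) _
      refine (lintegral_mono hpt).trans ?_
      rw [lintegral_const, measure_univ, mul_one]
    have hfin : ∀ᵐ J ∂couplingLaw G ν, H J < ⊤ :=
      ae_lt_top hH (hHle.trans_lt (by finiteness)).ne
    filter_upwards [hfin, hν.ae_ne_zero, hpos, hpos'] with J hJ hJ0 hJA hJA' hNk
    have htop := hT.tsum_measure_isDominated_update_eq_top hν hJ0 hA hA' hne hJA hJA'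
    have hle : ∑' e, ν {t | hT.IsDominated (Function.update J e t) e} ≤ H J + N J := by
      simp only [H, N]
      rw [← ENNReal.tsum_add]
      refine ENNReal.tsum_le_tsum fun e => ?_
      by_cases he : J ∈ X e
      · rw [Set.indicator_of_mem he]
        exact prob_le_one.trans le_add_self
      · rw [Set.indicator_of_mem (show J ∈ Y e from ⟨hNk, he⟩)]
        exact le_self_add
    rw [htop, top_le_iff, ENNReal.add_eq_top] at hle
    rcases hle with h | h
    · exact hJ.ne h
    · exact (hNk.trans_lt (ENNReal.natCast_lt_top k)).ne h
  filter_upwards [ae_all_iff.2 key] with J hJ hfin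
  refine hJ hfin.toFinset.card ?_
  simp only [N]
  rw [tsum_eq_sum (s := hfin.toFinset)]
  · rw [← nsmul_one, ← Finset.sum_const]
    exact Finset.sum_le_sum fun e _ => Set.indicator_le_self' (fun _ _ => zero_le) _
  · intro e he
    exact Set.indicator_of_notMem (s := X e) (fun h => he (hfin.mem_toFinset.2 h)) _

theorem ae_infinite_groundStates
    (h : ∀ᵐ J ∂couplingLaw G ν, 0 < T.flowTo (hT.onVertices fun e => |J e|) T.root) :
    ∀ᵐ J ∂couplingLaw G ν, (groundStates G J).Infinite := by
  have := T.countable_edgeSet G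
  filter_upwards [hν.ae_ne_zero, hT.ae_infinite_isDominated hν h] with J h1 h2
  exact hT.infinite_groundStates h1 h2

end RootedTree.Spans

end SpinGlass

end

theorem mainTheorem2 {V : Type*} (G : SimpleGraph V) [G.LocallyFinite] (hG : G.IsTree)
    (ν : Measure ℝ) [IsProbabilityMeasure ν] (hν : SpinGlass.IsLinearGrowth ν) :
    (∀ o : V,
      (∀ᵐ J ∂SpinGlass.couplingLaw G ν, 0 < SpinGlass.maxFlow G o (fun e => |J e|)) →
        ∀ᵐ J ∂SpinGlass.couplingLaw G ν, (SpinGlass.groundStates G J).Infinite) ∧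
    ((∀ᵐ J ∂SpinGlass.couplingLaw G ν, (SpinGlass.groundStates G J).encard = 2) ∨
      (∀ᵐ J ∂SpinGlass.couplingLaw G ν, (SpinGlass.groundStates G J).Infinite)) := by
  refine ⟨fun o h => ?_, ?_⟩
  · have hT := SpinGlass.rootedAt_spans G hG o
    refine hT.ae_infinite_groundStates hν ?_
    filter_upwards [h] with J hJ
    exact hT.flowTo_root_pos_of_maxFlow_pos (fun e => abs_nonneg _) hJ
  · obtain ⟨o⟩ := hG.connected.nonempty
    have hT := SpinGlass.rootedAt_spans G hG o
    have := (SpinGlass.rootedAt G hG o).countable_edgeSet G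
    rcases hT.flowTo_pos_zero_or_one hν (SpinGlass.rootedAt G hG o).root with h | h
    · exact Or.inr (hT.ae_infinite_groundStates hν h)
    · left
      filter_upwards [hν.ae_ne_zero, h] with J h1 h2
      exact hT.encard_groundStates_eq_two h1 (le_antisymm (not_lt.1 h2)
        (SpinGlass.RootedTree.flowTo_nonneg _ (hT.onVertices_nonneg fun e => abs_nonneg _) _))
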